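/- **Setting.** Let $\mathbf X=\mathbb Z\times[0,1]^{\mathbb N}$ with its Lebesgue measure. A *microcosm* is a monoid of non-singular measurable-preserving maps $\mathbf X\to\mathbf X$; $\mathfrak m_k$ is generated by the translations $(x,s)\mapsto(x+z,s)$, $z\in\mathbb Z$, and the maps $\mathtt p_\sigma:(x,s)\mapsto(x,\sigma(s))$ for the permutations $\sigma$ of the indices that fix every index $>k$; $\bar{\mathfrak m}_k$ is generated by $\mathfrak m_k$ and the translations modulo $1$ of the first entry of $s$. Weights are the elements $a$ and $a\cdot\mathbf 1$, $a\in[0,1]$, multiplied with $\mathbf 1\cdot\mathbf 1=\mathbf 1$; the parameter map is $m(a)=0$, $m(a\cdot\mathbf 1)=a$. A *graphing* of support $V\subseteq\mathbf X$ and finite dialect $D$ is a countable family of edges, each with a measurable source in $V$, an input and an output in $D$, a realiser $\mathbf X\to\mathbf X$ that maps the source into $V$, and a weight; it is an $\mathfrak m$-graphing if its realisers are in $\mathfrak m$, and finite if it refines a graphing with finitely many edges. The execution $F::G$ consists of the alternating paths between $F$ and $G$ (of non-null source), restricted to the points outside the common part of the supports that are mapped outside it. The measurement $[\![F,G]\!]$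 is the sum over all alternating circuits $\pi$ (cycles up to cyclic permutation, powers included) of $\int_{\mathrm{supp}\,\pi}m(\omega(\pi)^{\rho(x)})/\rho(x)\,dx$, with $\rho(x)$ the period of $x$ under the realiser of $\pi$ (the integrand is $0$ if $\rho(x)=\infty$). A project is a pair of a real number and a finite formal real combination of graphings of a given support; execution and measurement extend to projects by $[\![(a,\sum\alpha_iA_i),(b,\sum\beta_jB_j)]\!]=a\sum\beta_j+b\sum\alpha_i+\sum\alpha_i\beta_j[\![A_i,B_j]\!]$, and two projects are orthogonal ($\perp$) if their supports are equal and their measurement is neither $0$ nor infinite. The model is built over any ambient microcosm $\mathfrak u$ of measure-preserving maps that contains all the $\bar{\mathfrak m}_i$. Fix an injection $\Psi$ of $(\{\star,0,1\}\times\{\mathrm{in},\mathrm{out}\})\cup\{\mathrm a,\mathrm r\}$ in $\mathbb Z$ and put $[\![f]\!]=\{\Psi(f)\}\times[0,1]^{\mathbb N}$. A word $w=a_1\dots a_n$ over $\{0,1\}$ is written $\star a_1\dots a_n$ (so $a_0=\star$), with places counted modulo $n+1$. Its word graphing has dialect $\{0,\dots,n\}$ and, for each $i$, an edge from $[\![(a_i,\mathrm{out})]\!]$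 at $i$ to $[\![(a_{i+1},\mathrm{in})]\!]$ at $i+1$ and one from $[\![(a_i,\mathrm{in})]\!]$ at $i$ to $[\![(a_{i-1},\mathrm{out})]\!]$ at $i-1$, realised by translations and of weight $1$. Its representations are the promotions of this graphing with its dialect renamed along an injection in $\{0,\dots,N-1\}$: the state $d$ is moved into a new first entry $x\in[d/N,(d+1)/N]$ of the sequence, and the dialect becomes trivial. $\oc\mathrm{List}$ is the bi-orthogonal of all representations of words, $\mathbf{NBool}$ is the set of all projects of support $[\![\mathrm a]\!]\cup[\![\mathrm r]\!]$, and an *$\mathfrak m$-machine* is a finite $\mathfrak m$-graphing $M$, with all weights $1$, in $\oc\mathrm{List}\multimap\mathbf{NBool}$. The test $\mathcal T^-$ is the set of all $(\zeta,\mathrm{Id})$, $\zeta\in\mathbb R\setminus\{0\}$, where $\mathrm{Id}$ has a single edge, the identity on $[\![\mathrm r]\!]$ with weight $1\cdot\mathbf 1$. $\mathcal L_\exists(M)$ (resp. $\mathcal L_\forall(M)$) is the set of words $w$ such that for all $t\in\mathcal T^-$ and some (resp. every) representation $p$ of $w$, $M::p\perp t$. For $k\ge1$, a *$k$-head two-way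 automaton* has a finite set $Q$ of states with distinct states init, accept, reject, and a set of transitions $((\vec s,q),((i,d'),q'))$ with $\vec s\in\{\star,0,1\}^k$, $1\le i\le k$, $d'\in\{\mathrm{in},\mathrm{out}\}$. On $w$ it starts in init with all heads at place $0$; in a state $q\notin\{\text{accept},\text{reject}\}$ in which the heads read $\vec s$, such a transition moves head $i$ to the right ($d'=\mathrm{out}$) or to the left ($d'=\mathrm{in}$) and enters $q'$. It is required that in every computation all heads are at place $0$ when a transition into accept or reject is fired. It accepts $w$ if no computation on $w$ reaches reject. **The encoding.** $[A]$ has support $\bigcup_f[\![f]\!]$, dialect $Q\times\mathfrak G_k\times\{\star,0,1\}^k$, all weights $1$, and the following edges. For each transition $t=((\vec s,q),((i,d'),q'))$, $a\in\{\star,0,1\}$, $d\in\{\mathrm{in},\mathrm{out}\}$, $\sigma\in\mathfrak G_k$, an edge of source $[\![(s_{\sigma^{-1}(1)},d)]\!]$ with input $(q,\sigma,\vec s[\sigma^{-1}(1):=a])$. For each transition $t$ with $q=\mathrm{init}$ and $\vec s=(\star,\dots,\star)$, two edges of respective sources $[\![\mathrm a]\!]$ and $[\![\mathrm r]\!]$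 with input $(\mathrm{init},\mathrm{id},\vec\star)$; here $\sigma=\mathrm{id}$. The target is $[\![(s_i,d')]\!]$ with output $(q',\tau_{1,\sigma(i)}\circ\sigma,\vec s)$ if $q'\notin\{\text{accept},\text{reject}\}$, and otherwise $[\![\mathrm a]\!]$ (for accept) or $[\![\mathrm r]\!]$ (for reject) with output $(\mathrm{init},\mathrm{id},\vec\star)$. The realiser is $\mathtt p_{\tau_{1,\sigma(i)}}$ followed by the translation from the source region to the target region. **Theorem.** For every $k\ge1$ and every $k$-head two-way automaton $A$ as above (acyclic or not), $[A]$ is an $\mathfrak m_k$-machine and $\mathcal L_\exists([A])=\mathcal L_\forall([A])$ is the language accepted by $A$. In particular every language accepted by an (acyclic) $k$-head two-way automaton is computed by an $\mathfrak m_k$-machine with respect to $\mathcal T^-$. -/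

import Mathlib

open MeasureTheory Set
open scoped ENNReal

namespace InteractionGraphs

noncomputable section

/-! ## The space, microcosms -/

/-- The space `ℤ × [0,1]^ℕ`. -/
abbrev Space : Type := ℤ × (ℕ → unitInterval)

/-- Lebesgue measure: counting measure on `ℤ` times the product of the Lebesgue measures. -/
def lebesgue : Measure Space :=
  (Measure.count : Measure ℤ).prod (Measure.infinitePi fun _ : ℕ => (volume : Measure unitInterval))

/-- Non-singular measurable-preserving transformations. -/
structure IsNonsingular (f : Space → Space) : Prop where
  measurable : Measurable f
  measurableSet_image : ∀ A, MeasurableSet A → MeasurableSet (f '' A)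
  null_iff : ∀ A, MeasurableSet A → (lebesgue (f '' A) = 0 ↔ lebesgue A = 0)

/-- A microcosm: a monoid (under composition) of non-singular measurable-preserving maps. -/
structure Microcosm where
  carrier : Set (Space → Space)
  id_mem : id ∈ carrier
  comp_mem : ∀ f ∈ carrier, ∀ g ∈ carrier, f ∘ g ∈ carrier
  nonsingular : ∀ f ∈ carrier, IsNonsingular f

/-- The smallest monoid of maps containing `S`. -/
inductive Generated (S : Set (Space → Space)) : (Space → Space) → Prop
  | one : Generated S id
  | basic (f : Space → Space) : f ∈ S → Generated S f
  | comp (f g : Space → Space) : Generated S f → Generated S g → Generated S (f ∘ g)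

/-- The translation `(x, s) ↦ (x + z, s)`. -/
def translation (z : ℤ) : Space → Space := fun p => (p.1 + z, p.2)

/-- The map `(x, s) ↦ (x, σ(s))`, where `σ` moves the entry of index `j` to index `σ j`. -/
def permutation (σ : Equiv.Perm ℕ) : Space → Space := fun p => (p.1, fun j => p.2 (σ.symm j))

/-- The fractional part of `a + t`, as a point of `[0,1]`. -/
def shift (t : ℝ) (a : unitInterval) : unitInterval :=
  ⟨Int.fract ((a : ℝ) + t), Int.fract_nonneg _, (Int.fract_lt_one _).le⟩

/-- The sequence `a · s`. -/
def consSeq (a : unitInterval) (s : ℕ → unitInterval) : ℕ → unitInterval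
  | 0 => a
  | n + 1 => s n

/-- The sequence `s` with its first entry removed. -/
def tailSeq (s : ℕ → unitInterval) : ℕ → unitInterval := fun n => s (n + 1)

/-- The translation `(x, a · s) ↦ (x, (a + t mod 1) · s)`. -/
def rotation (t : ℝ) : Space → Space := fun p => (p.1, consSeq (shift t (p.2 0)) (tailSeq p.2))

/-- Generators of `𝔪ᵢ`. Sequences are indexed from `0`, so that the permutations which fix
all the places after the first `i` ones are those that fix every `j ≥ i`. -/
def generators (i : ℕ) : Set (Space → Space) :=
  {f | (∃ z : ℤ, f = translation z) ∨
    ∃ σ : Equiv.Perm ℕ, (∀ j, i ≤ j → σ j = j) ∧ f = permutation σ}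

theorem isNonsingular_of_equiv (e : Space ≃ᵐ Space)
    (h : MeasurePreserving e lebesgue lebesgue) : IsNonsingular e where
  measurable := e.measurable
  measurableSet_image A hA := by
    rw [e.image_eq_preimage_symm]; exact e.symm.measurable hA
  null_iff A hA := by
    have := h.measure_preimage_equiv (e '' A)
    rw [Set.preimage_image_eq _ e.injective] at this
    rw [this]

theorem IsNonsingular.comp {f g : Space → Space} (hf : IsNonsingular f) (hg : IsNonsingular g) :
    IsNonsingular (f ∘ g) where
  measurable := hf.measurable.comp hg.measurable
  measurableSet_image A hA := by
    rw [Set.image_comp]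
    exact hf.measurableSet_image _ (hg.measurableSet_image _ hA)
  null_iff A hA := by
    rw [Set.image_comp, hf.null_iff _ (hg.measurableSet_image _ hA), hg.null_iff _ hA]

theorem isNonsingular_translation (z : ℤ) : IsNonsingular (translation z) := by
  have h : MeasurePreserving (translation z) lebesgue lebesgue := by
    have h1 : MeasurePreserving (fun x : ℤ => x + z) Measure.count Measure.count :=
      measurePreserving_add_right _ z
    exact h1.prod (MeasurePreserving.id _)
  exact isNonsingular_of_equiv ((MeasurableEquiv.addRight z).prodCongr (MeasurableEquiv.refl _)) h

theorem isNonsingular_permutation (σ : Equiv.Perm ℕ) : IsNonsingular (permutation σ) := by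
  have h2 : MeasurePreserving (fun (s : ℕ → unitInterval) (j : ℕ) => s (σ.symm j))
      (Measure.infinitePi fun _ : ℕ => (volume : Measure unitInterval))
      (Measure.infinitePi fun _ : ℕ => (volume : Measure unitInterval)) :=
    ⟨by fun_prop, by
      have h := Measure.infinitePi_map_piCongrLeft
        (μ := fun _ : ℕ => (volume : Measure unitInterval)) σ
      have h' : ⇑(MeasurableEquiv.piCongrLeft (fun _ : ℕ => unitInterval) σ) =
          fun (s : ℕ → unitInterval) (j : ℕ) => s (σ.symm j) := by
        funext s j
        obtain ⟨i, rfl⟩ := σ.surjective j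
        rw [MeasurableEquiv.coe_piCongrLeft, Equiv.piCongrLeft_apply_apply, Equiv.symm_apply_apply]
      rwa [h'] at h⟩
  have h : MeasurePreserving (permutation σ) lebesgue lebesgue :=
    (MeasurePreserving.id (Measure.count : Measure ℤ)).prod h2
  let e : Space ≃ᵐ Space :=
    { toFun := permutation σ
      invFun := permutation σ.symm
      left_inv := fun p => by simp [permutation]
      right_inv := fun p => by simp [permutation]
      measurable_toFun := h.measurable
      measurable_invFun := by
        change Measurable (permutation σ.symm)
        unfold permutation
        fun_prop }
  exact isNonsingular_of_equiv e h

/-- The microcosm `𝔪ᵢ`. -/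
def microcosm (i : ℕ) : Microcosm where
  carrier := {f | Generated (generators i) f}
  id_mem := .one
  comp_mem f hf g hg := .comp f g hf hg
  nonsingular f hf := by
    induction hf with
    | one => exact isNonsingular_of_equiv (MeasurableEquiv.refl _) (MeasurePreserving.id _)
    | basic f h =>
      rcases h with ⟨z, rfl⟩ | ⟨σ, -, rfl⟩
      · exact isNonsingular_translation z
      · exact isNonsingular_permutation σ
    | comp f g _ _ hf hg => exact hf.comp hg

/-- The monoid `𝔪̄ᵢ`, generated by `𝔪ᵢ` and the translations modulo `1` of the first entry. -/
def microcosmBar (i : ℕ) : Set (Space → Space) :=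
  {f | Generated (generators i ∪ {f | ∃ t ∈ Icc (0 : ℝ) 1, f = rotation t}) f}

/-- The microcosms in which the ambient model can be built: they consist of measure-preserving
maps and contain `𝔪̄_∞`, the union of the `𝔪̄ᵢ`. -/
structure Microcosm.IsAmbient (u : Microcosm) : Prop where
  measurePreserving : ∀ f ∈ u.carrier, MeasurePreserving f lebesgue lebesgue
  bar_subset : ∀ i, microcosmBar i ⊆ u.carrier

/-! ## Weights, graphings -/

/-- Weights: `⟨a, false⟩` stands for `a` and `⟨a, true⟩` for `a · 𝟏`. -/
@[ext] structure Weight where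
  val : unitInterval
  flag : Bool

instance : Monoid Weight where
  mul a b := ⟨a.val * b.val, a.flag || b.flag⟩
  one := ⟨1, false⟩
  mul_assoc a b c := Weight.ext (mul_assoc _ _ _) (Bool.or_assoc _ _ _)
  one_mul a := Weight.ext (one_mul _) (Bool.false_or _)
  mul_one a := Weight.ext (mul_one _) (Bool.or_false _)

/-- The parameter map: `a ↦ 0` and `a · 𝟏 ↦ a`. -/
def Weight.param (w : Weight) : ℝ≥0∞ := if w.flag then ENNReal.ofReal (w.val : ℝ) else 0

/-- The data `(S, i, o, φ, ω)` carried by an edge. -/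
structure Arrow (D : Type) where
  src : Set Space
  inn : D
  out : D
  map : Space → Space
  wt : Weight

/-- Graphing representatives. The microcosm is mentioned separately, in `Graphing.IsIn`. -/
structure Graphing where
  supp : Set Space
  measurableSet_supp : MeasurableSet supp
  Dialect : Type
  finite_dialect : Finite Dialect
  Edge : Type
  countable_edge : Countable Edge
  arrow : Edge → Arrow Dialect
  measurableSet_src : ∀ e, MeasurableSet (arrow e).src
  measurable_map : ∀ e, Measurable (arrow e).map
  src_subset : ∀ e, (arrow e).src ⊆ supp
  target_subset : ∀ e, (arrow e).map '' (arrow e).src ⊆ supp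

/-- `G` is an `𝔪`-graphing. -/
def Graphing.IsIn (m : Microcosm) (G : Graphing) : Prop := ∀ e, (G.arrow e).map ∈ m.carrier

/-- `F` is a refinement of `G`; `part` gives the partition of the edges of `F`, and the
dialects are identified by a bijection. -/
def Graphing.Refines (F G : Graphing) : Prop :=
  F.supp = G.supp ∧ ∃ (c : F.Dialect ≃ G.Dialect) (part : F.Edge → G.Edge),
    (∀ e, (⋃ f ∈ {f | part f = e}, (F.arrow f).src) =ᵐ[lebesgue] (G.arrow e).src) ∧
    (∀ f f', f ≠ f' → part f = part f' →
      lebesgue ((F.arrow f).src ∩ (F.arrow f').src) = 0) ∧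
    ∀ f, (F.arrow f).wt = (G.arrow (part f)).wt ∧ (F.arrow f).map = (G.arrow (part f)).map ∧
      c (F.arrow f).inn = (G.arrow (part f)).inn ∧ c (F.arrow f).out = (G.arrow (part f)).out

/-- `G` is finite: it is a refinement of a graphing with finitely many edges. -/
def Graphing.IsFinite (G : Graphing) : Prop := ∃ H : Graphing, G.Refines H ∧ Finite H.Edge

/-! ## Paths, execution, measurement -/

/-- The points from which a sequence of edges can be followed. -/
def pathSrc {D : Type} : List (Arrow D) → Set Space
  | [] => univ
  | a :: l => a.src ∩ a.map ⁻¹' pathSrc l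

/-- The map realising a sequence of edges: first edge first. -/
def pathMap {D : Type} : List (Arrow D) → Space → Space
  | [] => id
  | a :: l => pathMap l ∘ a.map

/-- The weight of a sequence of edges. -/
def pathWt {D : Type} (l : List (Arrow D)) : Weight := (l.map Arrow.wt).prod

/-- An edge of `F` or of `G`, seen over the dialect `D^F × D^G`: an edge of `F` leaves the second
component unchanged, an edge of `G` the first one. Along an alternating path `e₁, e₂, …` this
amounts to `o(eᵢ) = i(eᵢ₊₂)`. -/
def Step (F G : Graphing) : Type := (F.Edge × G.Dialect) ⊕ (G.Edge × F.Dialect)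

def Step.isLeft {F G : Graphing} : Step F G → Bool
  | .inl _ => true
  | .inr _ => false

def Step.arrow {F G : Graphing} : Step F G → Arrow (F.Dialect × G.Dialect)
  | .inl (e, d) => ⟨(F.arrow e).src, ((F.arrow e).inn, d), ((F.arrow e).out, d),
      (F.arrow e).map, (F.arrow e).wt⟩
  | .inr (e, d) => ⟨(G.arrow e).src, (d, (G.arrow e).inn), (d, (G.arrow e).out),
      (G.arrow e).map, (G.arrow e).wt⟩

/-- `t` may come right after `s` in an alternating path. -/
def Step.Follows {F G : Graphing} (s t : Step F G) : Prop :=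
  s.isLeft ≠ t.isLeft ∧ s.arrow.out = t.arrow.inn

/-- Alternating paths: non-empty, and with a source of positive measure. -/
def IsAltPath {F G : Graphing} (l : List (Step F G)) : Prop :=
  l ≠ [] ∧ l.IsChain Step.Follows ∧ lebesgue (pathSrc (l.map Step.arrow)) ≠ 0

theorem Step.measurableSet_src {F G : Graphing} (s : Step F G) : MeasurableSet s.arrow.src := by
  rcases s with ⟨e, d⟩ | ⟨e, d⟩
  · exact F.measurableSet_src e
  · exact G.measurableSet_src e

theorem Step.measurable_map {F G : Graphing} (s : Step F G) : Measurable s.arrow.map := by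
  rcases s with ⟨e, d⟩ | ⟨e, d⟩
  · exact F.measurable_map e
  · exact G.measurable_map e

theorem Step.src_subset {F G : Graphing} (s : Step F G) : s.arrow.src ⊆ F.supp ∪ G.supp := by
  rcases s with ⟨e, d⟩ | ⟨e, d⟩
  · exact (F.src_subset e).trans subset_union_left
  · exact (G.src_subset e).trans subset_union_right

theorem Step.target_subset {F G : Graphing} (s : Step F G) :
    s.arrow.map '' s.arrow.src ⊆ F.supp ∪ G.supp := by
  rcases s with ⟨e, d⟩ | ⟨e, d⟩
  · exact (F.target_subset e).trans subset_union_left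
  · exact (G.target_subset e).trans subset_union_right

theorem measurable_pathMap {F G : Graphing} (l : List (Step F G)) :
    Measurable (pathMap (l.map Step.arrow)) := by
  induction l with
  | nil => exact measurable_id
  | cons s l ih => exact ih.comp s.measurable_map

theorem measurableSet_pathSrc {F G : Graphing} (l : List (Step F G)) :
    MeasurableSet (pathSrc (l.map Step.arrow)) := by
  induction l with
  | nil => exact MeasurableSet.univ
  | cons s l ih => exact s.measurableSet_src.inter (s.measurable_map ih)

theorem pathSrc_subset {F G : Graphing} (l : List (Step F G)) (hl : l ≠ []) :
    pathSrc (l.map Step.arrow) ⊆ F.supp ∪ G.supp := by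
  cases l with
  | nil => exact absurd rfl hl
  | cons s l => exact inter_subset_left.trans s.src_subset

theorem pathMap_mem {F G : Graphing} (l : List (Step F G)) (x : Space)
    (h0 : x ∈ F.supp ∪ G.supp) (hx : x ∈ pathSrc (l.map Step.arrow)) :
    pathMap (l.map Step.arrow) x ∈ F.supp ∪ G.supp := by
  induction l generalizing x with
  | nil => exact h0
  | cons s l ih => exact ih _ (s.target_subset ⟨x, hx.1, rfl⟩) hx.2

instance (F G : Graphing) : Countable (Step F G) := by
  have := F.countable_edge
  have := G.countable_edge
  have := F.finite_dialect
  have := G.finite_dialect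
  unfold Step
  infer_instance

/-- The execution of `F` and `G`: all alternating paths between them, restricted to the points
that lie outside the common part `C` of the supports and are mapped outside `C`. -/
def Graphing.plug (F G : Graphing) : Graphing where
  supp := (F.supp \ G.supp) ∪ (G.supp \ F.supp)
  measurableSet_supp := (F.measurableSet_supp.diff G.measurableSet_supp).union
    (G.measurableSet_supp.diff F.measurableSet_supp)
  Dialect := F.Dialect × G.Dialect
  finite_dialect := by
    have := F.finite_dialect
    have := G.finite_dialect
    infer_instance
  Edge := {l : List (Step F G) // IsAltPath l}
  countable_edge := inferInstance
  arrow l :=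
    { src := pathSrc (l.1.map Step.arrow) ∩ (F.supp ∩ G.supp)ᶜ ∩
        pathMap (l.1.map Step.arrow) ⁻¹' (F.supp ∩ G.supp)ᶜ
      inn := (l.1.head l.2.1).arrow.inn
      out := (l.1.getLast l.2.1).arrow.out
      map := pathMap (l.1.map Step.arrow)
      wt := pathWt (l.1.map Step.arrow) }
  measurableSet_src l :=
    ((measurableSet_pathSrc l.1).inter
      (F.measurableSet_supp.inter G.measurableSet_supp).compl).inter
      (measurable_pathMap l.1 (F.measurableSet_supp.inter G.measurableSet_supp).compl)
  measurable_map l := measurable_pathMap l.1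
  src_subset l := by
    rintro x ⟨⟨hx, hC⟩, -⟩
    have h := pathSrc_subset l.1 l.2.1 hx
    simp only [mem_compl_iff, mem_inter_iff, mem_union, mem_sdiff] at *
    tauto
  target_subset l := by
    rintro _ ⟨x, ⟨⟨hx, -⟩, hC⟩, rfl⟩
    have h := pathMap_mem l.1 x (pathSrc_subset l.1 l.2.1 hx) hx
    simp only [mem_compl_iff, mem_inter_iff, mem_union, mem_sdiff, mem_preimage] at *
    tauto

/-- Circuits: alternating cycles up to cyclic permutation (powers of a cycle included). -/
def Circuit (F G : Graphing) : Type :=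
  {c : Cycle (Step F G) // c ≠ Cycle.nil ∧ c.Chain Step.Follows}

/-- The points around which a cycle can be followed for ever. -/
def cycleSupp {D : Type} (l : List (Arrow D)) : Set Space :=
  {x | ∀ n : ℕ, (pathMap l)^[n] x ∈ pathSrc l}

open Classical in
/-- The contribution `∫_{supp π} m(ω(π)^ρ(x)) / ρ(x) dx` of a cycle `π`. Here `ρ(x)` is the
least `n ≥ 1` with `φ_πⁿ(x) = x`, and the integrand is `0` if there is none (`ρ(x) = ∞`). -/
def cycleTerm {D : Type} (l : List (Arrow D)) : ℝ≥0∞ :=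
  ∫⁻ x in cycleSupp l,
    if x ∈ Function.periodicPts (pathMap l) then
      ((pathWt l) ^ (Function.minimalPeriod (pathMap l) x)).param /
        (Function.minimalPeriod (pathMap l) x : ℝ≥0∞)
    else 0 ∂lebesgue

/-- The measurement of two graphings: a sum over circuits, each one represented by a cycle. -/
def measurement (F G : Graphing) : ℝ≥0∞ :=
  ∑' c : Circuit F G, cycleTerm ((Quotient.out c.1 : List (Step F G)).map Step.arrow)

/-! ## Projects -/

/-- A project: a real number and a finite formal weighted sum of graphings of a given support. -/
structure Project where
  supp : Set Space
  measurableSet_supp : MeasurableSet supp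
  wager : ℝ
  Index : Type
  fintype_index : Fintype Index
  coeff : Index → ℝ
  slice : Index → Graphing
  slice_supp : ∀ i, (slice i).supp = supp

attribute [instance] Project.fintype_index

namespace Project

/-- All the graphings of the project are `𝔪`-graphings. -/
def IsIn (m : Microcosm) (p : Project) : Prop := ∀ i, (p.slice i).IsIn m

/-- The project `(a, G)`. -/
def ofGraphing (a : ℝ) (G : Graphing) : Project where
  supp := G.supp
  measurableSet_supp := G.measurableSet_supp
  wager := a
  Index := Unit
  fintype_index := inferInstance
  coeff _ := 1
  slice _ := G
  slice_supp _ := rfl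

/-- The measurement of two projects is finite. -/
def MeasFinite (p q : Project) : Prop :=
  ∀ i j, p.coeff i * q.coeff j ≠ 0 → measurement (p.slice i) (q.slice j) ≠ ⊤

/-- The measurement of two projects; it is meant to be used together with `MeasFinite`. -/
def meas (p q : Project) : ℝ :=
  p.wager * (∑ j, q.coeff j) + q.wager * (∑ i, p.coeff i) +
    ∑ i, ∑ j, p.coeff i * q.coeff j * (measurement (p.slice i) (q.slice j)).toReal

/-- Orthogonality: equal supports, and a measurement which is neither `0` nor infinite. -/
def Orth (p q : Project) : Prop := p.supp = q.supp ∧ MeasFinite p q ∧ meas p q ≠ 0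

/-- Execution of projects; its wager makes sense when `MeasFinite p q`. -/
def plug (p q : Project) : Project where
  supp := (p.supp \ q.supp) ∪ (q.supp \ p.supp)
  measurableSet_supp := (p.measurableSet_supp.diff q.measurableSet_supp).union
    (q.measurableSet_supp.diff p.measurableSet_supp)
  wager := meas p q
  Index := p.Index × q.Index
  fintype_index := inferInstance
  coeff x := p.coeff x.1 * q.coeff x.2
  slice x := (p.slice x.1).plug (q.slice x.2)
  slice_supp x := by simp [Graphing.plug, p.slice_supp, q.slice_supp]

/-- The orthogonal of a set of projects, in the model over the ambient microcosm `u`. -/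
def orthogonal (u : Microcosm) (E : Set Project) : Set Project :=
  {q | q.IsIn u ∧ ∀ p ∈ E, Orth p q}

/-- The conduct `A ⊸ B` over `u`, for sets of projects of respective supports `V` and `W`. -/
def limp (u : Microcosm) (V W : Set Space) (A B : Set Project) : Set Project :=
  {f | f.IsIn u ∧ f.supp = V ∪ W ∧ ∀ a ∈ A, MeasFinite f a ∧ plug f a ∈ B}

end Project

/-! ## Words -/

/-- The extended alphabet `{⋆, 0, 1}`: `none` is `⋆`, `some b` is a bit. -/
abbrev Sym : Type := Option Bool

/-- Directions. -/
inductive Dir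
  | inn
  | out

/-- The set `({⋆,0,1} × {in,out}) ∪ {a, r}`. -/
inductive Vertex
  | ext (s : Sym) (d : Dir)
  | acc
  | rej

/-- The subset `⟦f⟧` of the space. -/
def region (Ψ : Vertex ↪ ℤ) (f : Vertex) : Set Space := {p | p.1 = Ψ f}

/-- The support `⟦{⋆,0,1} × {in,out}⟧` of words. -/
def wordSupport (Ψ : Vertex ↪ ℤ) : Set Space := ⋃ s : Sym, ⋃ d : Dir, region Ψ (.ext s d)

/-- The support `⟦{a, r}⟧` of results. -/
def resultSupport (Ψ : Vertex ↪ ℤ) : Set Space := region Ψ .acc ∪ region Ψ .rej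

theorem measurableSet_region (Ψ : Vertex ↪ ℤ) (f : Vertex) : MeasurableSet (region Ψ f) :=
  measurable_fst (measurableSet_singleton (Ψ f))

instance : Finite Dir :=
  Finite.of_surjective (fun b : Bool => cond b Dir.inn Dir.out)
    fun d => by cases d; exacts [⟨true, rfl⟩, ⟨false, rfl⟩]

theorem measurableSet_wordSupport (Ψ : Vertex ↪ ℤ) : MeasurableSet (wordSupport Ψ) :=
  .iUnion fun _ => .iUnion fun _ => measurableSet_region _ _

theorem measurableSet_resultSupport (Ψ : Vertex ↪ ℤ) : MeasurableSet (resultSupport Ψ) :=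
  (measurableSet_region _ _).union (measurableSet_region _ _)

theorem region_subset_wordSupport (Ψ : Vertex ↪ ℤ) (s : Sym) (d : Dir) :
    region Ψ (.ext s d) ⊆ wordSupport Ψ :=
  subset_iUnion_of_subset s (subset_iUnion_of_subset d Subset.rfl)

theorem translation_region (Ψ : Vertex ↪ ℤ) (f g : Vertex) (x : Space) (hx : x ∈ region Ψ f) :
    translation (Ψ g - Ψ f) x ∈ region Ψ g := by
  have h : x.1 = Ψ f := hx
  simp [region, translation, h]

theorem measurable_translation (z : ℤ) : Measurable (translation z) :=
  (isNonsingular_translation z).measurable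

/-- The letter at place `i` of `⋆ a₁ … aₙ`. -/
def letter (w : List Bool) : Fin (w.length + 1) → Sym := Fin.cons none fun i => some (w.get i)

/-- Source vertex of the edge `(r, i)` (`right = true`) or `(l, i)` of the graph of `w`. -/
def wordSrc (w : List Bool) (right : Bool) (i : Fin (w.length + 1)) : Vertex :=
  .ext (letter w i) (if right then .out else .inn)

/-- The neighbour of the place `i`; places are counted modulo `n + 1`. -/
def neighbour {n : ℕ} (right : Bool) (i : Fin (n + 1)) : Fin (n + 1) :=
  if right then i + 1 else i - 1

/-- Target vertex of the edge `(r, i)` or `(l, i)` of the graph of `w`. -/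
def wordTgt (w : List Bool) (right : Bool) (i : Fin (w.length + 1)) : Vertex :=
  .ext (letter w (neighbour right i)) (if right then .inn else .out)

/-- The word graphing of `w`. -/
def wordGraphing (Ψ : Vertex ↪ ℤ) (w : List Bool) : Graphing where
  supp := wordSupport Ψ
  measurableSet_supp := measurableSet_wordSupport Ψ
  Dialect := Fin (w.length + 1)
  finite_dialect := inferInstance
  Edge := Bool × Fin (w.length + 1)
  countable_edge := inferInstance
  arrow e :=
    { src := region Ψ (wordSrc w e.1 e.2)
      inn := e.2
      out := neighbour e.1 e.2
      map := translation (Ψ (wordTgt w e.1 e.2) - Ψ (wordSrc w e.1 e.2))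
      wt := 1 }
  measurableSet_src _ := measurableSet_region _ _
  measurable_map _ := measurable_translation _
  src_subset _ := region_subset_wordSupport _ _ _
  target_subset e := by
    rintro _ ⟨x, hx, rfl⟩
    exact region_subset_wordSupport _ _ _ (translation_region _ _ _ _ hx)

/-- The set of the `(a, x · s)` with `(a, s) ∈ A` and `d ≤ N x ≤ d + 1`. -/
def pushSet (N : ℕ) (d : Fin N) (A : Set Space) : Set Space :=
  {p | (p.1, tailSeq p.2) ∈ A ∧ (d : ℝ) ≤ N * (p.2 0 : ℝ) ∧ N * (p.2 0 : ℝ) ≤ d + 1}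

/-- The map `(a, x · s) ↦ (a', y · s')` with `(a', s') = f (a, s)` and `y = x + (d' - d) / N`
(modulo `1`, so as to be defined everywhere). -/
def pushMap (N : ℕ) (d d' : Fin N) (f : Space → Space) : Space → Space := fun p =>
  ((f (p.1, tailSeq p.2)).1,
    consSeq (shift (((d' : ℝ) - d) / N) (p.2 0)) (f (p.1, tailSeq p.2)).2)

theorem measurable_tail : Measurable fun p : Space => (p.1, tailSeq p.2) := by
  unfold tailSeq; fun_prop

theorem measurable_shift (t : ℝ) : Measurable (shift t) :=
  (measurable_fract.comp (measurable_subtype_coe.add_const t)).subtype_mk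

theorem measurable_pushMap (N : ℕ) (d d' : Fin N) {f : Space → Space} (hf : Measurable f) :
    Measurable (pushMap N d d' f) := by
  have h1 : Measurable fun p : Space => f (p.1, tailSeq p.2) := hf.comp measurable_tail
  refine (measurable_fst.comp h1).prodMk (measurable_pi_lambda _ fun n => ?_)
  cases n with
  | zero => exact (measurable_shift _).comp ((measurable_pi_apply 0).comp measurable_snd)
  | succ n => exact (measurable_pi_apply n).comp (measurable_snd.comp h1)

/-- The promotion `!G'`, where `G'` is `G` with its dialect renamed along `c`; its dialect is
trivial. -/
def Graphing.bang (G : Graphing) {N : ℕ} (c : G.Dialect ↪ Fin N) : Graphing where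
  supp := {p | (p.1, tailSeq p.2) ∈ G.supp}
  measurableSet_supp := measurable_tail G.measurableSet_supp
  Dialect := Fin 1
  finite_dialect := inferInstance
  Edge := G.Edge
  countable_edge := G.countable_edge
  arrow e :=
    { src := pushSet N (c (G.arrow e).inn) (G.arrow e).src
      inn := 0
      out := 0
      map := pushMap N (c (G.arrow e).inn) (c (G.arrow e).out) (G.arrow e).map
      wt := (G.arrow e).wt }
  measurableSet_src e := by
    have h0 : Measurable fun p : Space => (N : ℝ) * (p.2 0 : ℝ) := by fun_prop
    exact (measurable_tail (G.measurableSet_src e)).inter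
      ((measurableSet_le measurable_const h0).inter (measurableSet_le h0 measurable_const))
  measurable_map e := measurable_pushMap _ _ _ (G.measurable_map e)
  src_subset e := fun _ hp => G.src_subset e hp.1
  target_subset e := by
    rintro _ ⟨p, hp, rfl⟩
    exact G.target_subset e ⟨_, hp.1, rfl⟩

/-- The representations of the word `w`. -/
def wordReps (Ψ : Vertex ↪ ℤ) (w : List Bool) : Set Project :=
  {p | ∃ (N : ℕ) (c : Fin (w.length + 1) ↪ Fin N),
    p = Project.ofGraphing 0 ((wordGraphing Ψ w).bang c)}

/-- The conduct of words: the bi-orthogonal of the set of all representations of words. -/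
def bangList (u : Microcosm) (Ψ : Vertex ↪ ℤ) : Set Project :=
  Project.orthogonal u (Project.orthogonal u (⋃ w, wordReps Ψ w))

/-- The type of results: all projects of support `⟦{a, r}⟧`. -/
def nBool (u : Microcosm) (Ψ : Vertex ↪ ℤ) : Set Project :=
  {p | p.IsIn u ∧ p.supp = resultSupport Ψ}

/-! ## Machines, tests, languages -/

/-- Nondeterministic predicate `𝔪`-machines. -/
structure IsMachine (u : Microcosm) (Ψ : Vertex ↪ ℤ) (m : Microcosm) (M : Graphing) : Prop where
  isIn : M.IsIn m
  mem_type : Project.ofGraphing 0 M ∈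
    Project.limp u (wordSupport Ψ) (resultSupport Ψ) (bangList u Ψ) (nBool u Ψ)
  finite : M.IsFinite
  weight_one : ∀ e, (M.arrow e).wt = 1

/-- `M` plugged to the representation `p` is defined and orthogonal to `t`. -/
def Passes (M : Graphing) (p t : Project) : Prop :=
  Project.MeasFinite (.ofGraphing 0 M) p ∧ Project.Orth ((Project.ofGraphing 0 M).plug p) t

/-- The existential language of `M` with respect to the test `T`. -/
def languageExists (Ψ : Vertex ↪ ℤ) (T : Set Project) (M : Graphing) : Set (List Bool) :=
  {w | ∀ t ∈ T, ∃ p ∈ wordReps Ψ w, Passes M p t}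

/-- The universal language of `M` with respect to the test `T`. -/
def languageForall (Ψ : Vertex ↪ ℤ) (T : Set Project) (M : Graphing) : Set (List Bool) :=
  {w | ∀ t ∈ T, ∀ p ∈ wordReps Ψ w, Passes M p t}

/-- The graphing with a single edge, the identity on `⟦r⟧`, of weight `1 · 𝟏`. -/
def idReject (Ψ : Vertex ↪ ℤ) : Graphing where
  supp := resultSupport Ψ
  measurableSet_supp := measurableSet_resultSupport Ψ
  Dialect := Fin 1
  finite_dialect := inferInstance
  Edge := Unit
  countable_edge := inferInstance
  arrow _ := ⟨region Ψ .rej, 0, 0, id, ⟨1, true⟩⟩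
  measurableSet_src _ := measurableSet_region _ _
  measurable_map _ := measurable_id
  src_subset _ := subset_union_right
  target_subset _ := by simp [resultSupport]

/-- The test `T⁻`. -/
def testNeg (Ψ : Vertex ↪ ℤ) : Set Project :=
  {p | ∃ ζ : ℝ, ζ ≠ 0 ∧ p = Project.ofGraphing ζ (idReject Ψ)}

/-! ## Automata -/

/-- A transition `((s, q), ((i, d), q'))`. -/
abbrev Transition (k : ℕ) (Q : Type) : Type := ((Fin k → Sym) × Q) × ((Fin k × Dir) × Q)

/-- Two-way automata with `k` heads and set of states `Q`. -/
structure Automaton (k : ℕ) (Q : Type) where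
  init : Q
  accept : Q
  reject : Q
  init_ne_accept : init ≠ accept
  init_ne_reject : init ≠ reject
  accept_ne_reject : accept ≠ reject
  rel : Set (Transition k Q)

namespace Automaton

variable {k : ℕ} {Q : Type}

/-- Configurations on the input `w`: the places of the heads, and a state. -/
abbrev Config (k : ℕ) (Q : Type) (w : List Bool) : Type := (Fin k → Fin (w.length + 1)) × Q

/-- The accepting and rejecting states. -/
def Halting (A : Automaton k Q) (q : Q) : Prop := q = A.accept ∨ q = A.reject

/-- The transition `t` can be fired in the configuration `c`. -/
def Enabled (A : Automaton k Q) (w : List Bool) (c : Config k Q w) (t : Transition k Q) : Prop :=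
  t ∈ A.rel ∧ ¬ A.Halting c.2 ∧ t.1 = (fun j => letter w (c.1 j), c.2)

/-- Moving to the right for the direction `out`, and to the left for `inn`. -/
def move {n : ℕ} : Dir → Fin (n + 1) → Fin (n + 1)
  | .out, p => neighbour true p
  | .inn, p => neighbour false p

/-- One computation step: exactly one head moves. -/
def StepRel (A : Automaton k Q) (w : List Bool) (c c' : Config k Q w) : Prop :=
  ∃ t, A.Enabled w c t ∧
    c' = (Function.update c.1 t.2.1.1 (move t.2.1.2 (c.1 t.2.1.1)), t.2.2)

/-- `c` is reached by a computation trace on `w`. -/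
def Reachable (A : Automaton k Q) (w : List Bool) (c : Config k Q w) : Prop :=
  Relation.ReflTransGen (A.StepRel w) (fun _ => 0, A.init) c

/-- All heads are back on the left end-marker when the automaton accepts or rejects. -/
def Repositions (A : Automaton k Q) : Prop :=
  ∀ (w : List Bool) (c : Config k Q w) (t : Transition k Q),
    A.Reachable w c → A.Enabled w c t → A.Halting t.2.2 → ∀ j, c.1 j = 0

/-- `w` is accepted when no computation trace leads to the rejecting state. -/
def language (A : Automaton k Q) : Set (List Bool) :=
  {w | ¬ ∃ c : Config k Q w, A.Reachable w c ∧ c.2 = A.reject}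

/-! ### Automata as machines -/

/-- Edges of the encoding: starting edges `(t, d)`, for the transitions `t` that can be fired in
the initial configuration, and `(t, a, d, σ)`, for all transitions `t`. -/
abbrev EncEdge (A : Automaton k Q) : Type :=
  ({t : Transition k Q // t ∈ A.rel ∧ t.1 = (fun _ => none, A.init)} × Dir) ⊕
    ({t : Transition k Q // t ∈ A.rel} × Sym × Dir × Equiv.Perm (Fin k))

/-- The encoding's dialect. In `(q, σ, s)`, `q` is the state of the automaton, `σ i` is the place
of the space at which the position of the head `i` is stored, and `s` is the last record of the
symbols read by the heads. -/
abbrev EncDialect (k : ℕ) (Q : Type) : Type := Q × Equiv.Perm (Fin k) × (Fin k → Sym)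

variable [NeZero k]

/-- The transition underlying an edge. -/
def EncEdge.transition {A : Automaton k Q} : A.EncEdge → Transition k Q
  | .inl (t, _) => t.1
  | .inr (t, _) => t.1

/-- The permutation recorded at the source of an edge. -/
def EncEdge.perm {A : Automaton k Q} : A.EncEdge → Equiv.Perm (Fin k)
  | .inl _ => 1
  | .inr (_, _, _, σ) => σ

/-- Source vertex: `a` or `r` for the starting edges; otherwise `(b, d)` where `b` is the symbol
read by the head that has just moved, which is the one stored at the first place. -/
def EncEdge.srcVertex {A : Automaton k Q} : A.EncEdge → Vertex
  | .inl (_, .inn) => .acc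
  | .inl (_, .out) => .rej
  | .inr (t, _, d, σ) => .ext (t.1.1.1 (σ.symm 0)) d

/-- Source dialect: the record is out of date for the head that has just moved: it has some
arbitrary symbol `a` there. -/
def EncEdge.srcDialect {A : Automaton k Q} : A.EncEdge → EncDialect k Q
  | .inl _ => (A.init, 1, fun _ => none)
  | .inr (t, a, _, σ) => (t.1.1.2, σ, Function.update t.1.1.1 (σ.symm 0) a)

open Classical in
/-- Target vertex. -/
def EncEdge.tgtVertex {A : Automaton k Q} (e : A.EncEdge) : Vertex :=
  if e.transition.2.2 = A.accept then .acc
  else if e.transition.2.2 = A.reject then .rej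
  else .ext (e.transition.1.1 e.transition.2.1.1) e.transition.2.1.2

open Classical in
/-- Target dialect. -/
def EncEdge.tgtDialect {A : Automaton k Q} (e : A.EncEdge) : EncDialect k Q :=
  if A.Halting e.transition.2.2 then (A.init, 1, fun _ => none)
  else (e.transition.2.2, Equiv.swap 0 (e.perm e.transition.2.1.1) * e.perm, e.transition.1.1)

/-- Realiser: the transposition of the first place and the place of the head to be moved, composed
with the translation from the source vertex to the target vertex. -/
def EncEdge.realiser (Ψ : Vertex ↪ ℤ) {A : Automaton k Q} (e : A.EncEdge) : Space → Space :=
  translation (Ψ e.tgtVertex - Ψ e.srcVertex) ∘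
    permutation (Equiv.swap 0 ((e.perm e.transition.2.1.1 : Fin k) : ℕ))

theorem region_subset_union (Ψ : Vertex ↪ ℤ) (f : Vertex) :
    region Ψ f ⊆ wordSupport Ψ ∪ resultSupport Ψ := by
  cases f with
  | ext s d => exact (region_subset_wordSupport Ψ s d).trans subset_union_left
  | acc => exact subset_union_left.trans subset_union_right
  | rej => exact subset_union_right.trans subset_union_right

/-- The graphing `[A]` that encodes the automaton `A`. -/
def encode [Finite Q] (Ψ : Vertex ↪ ℤ) (A : Automaton k Q) : Graphing where
  supp := wordSupport Ψ ∪ resultSupport Ψ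
  measurableSet_supp := (measurableSet_wordSupport Ψ).union (measurableSet_resultSupport Ψ)
  Dialect := EncDialect k Q
  finite_dialect := inferInstance
  Edge := A.EncEdge
  countable_edge := inferInstance
  arrow e :=
    { src := region Ψ e.srcVertex
      inn := e.srcDialect
      out := e.tgtDialect
      map := e.realiser Ψ
      wt := 1 }
  measurableSet_src _ := measurableSet_region _ _
  measurable_map _ :=
    (measurable_translation _).comp (isNonsingular_permutation _).measurable
  src_subset _ := region_subset_union Ψ _
  target_subset e := by
    rintro _ ⟨x, hx, rfl⟩
    refine region_subset_union Ψ e.tgtVertex (translation_region Ψ _ _ _ ?_)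
    exact hx

end Automaton

end

end InteractionGraphs

open InteractionGraphs

/-!
`[A]` and the words only carry the weight `1`, whose parameter is `0`; so they interact trivially
with each other, and the only weight that a measurement sees is the `1 · 𝟏` of the test.

`[A]` is a machine because circuits only see the common part of the supports
(`measurement_le_restrict`). The restriction of `[A]` to the support of words, with wager `1`, is
orthogonal to all words; so each project of `!List` has a finite measurement against this
restriction, hence against `[A]`.

A test of `T⁻` is a wager `ζ ≠ 0` and a loop on `⟦r⟧`. It remains to see that the measurement of
`[A] :: w` against this loop is `0` when `w` is accepted and `∞` when it is rejected, for each
representation of `w`: then `ζ` plays no role, and the two languages coincide.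

* Away from the null set of the points with some entry of the form `n / N`, `n ∈ ℤ`, an entry determines at most one
  place, and a path that leads to `⟦r⟧` follows a computation of `A` (`exists_reachable_reject`). The
  starting edges accept any entries; but a head that has not moved yet has been read as `⋆`, which
  occurs at the place `0` only, so that its first move is one from the place `0`. Hence, for an
  accepted word, the supports of all circuits are null.
* Conversely a computation is followed by a path from the points whose first `k` entries stand for
  the place `0` (`exists_tracks`); each entry is shifted by the displacement of the head that it
  stands for, and the entries are permuted. If the computation rejects, all displacements vanish at
  the end, so that the path from `⟦r⟧` to `⟦r⟧` only permutes the first `k` entries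
  (`exists_rejecting_path`). Plugged with the loop it forms a circuit of finite order on a set of
  positive measure; infinitely many powers of this circuit contribute at least the same positive
  amount each (`measurement_eq_top`).
-/

namespace InteractionGraphs

/-! ### Paths and circuits -/

theorem pathSrc_append {D : Type} (l l' : List (Arrow D)) :
    pathSrc (l ++ l') = pathSrc l ∩ pathMap l ⁻¹' pathSrc l' := by
  induction l with
  | nil => simp [pathSrc, pathMap]
  | cons a l ih => simp [pathSrc, pathMap, ih, preimage_comp, inter_assoc]

theorem pathMap_append {D : Type} (l l' : List (Arrow D)) :
    pathMap (l ++ l') = pathMap l' ∘ pathMap l := by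
  induction l with
  | nil => simp [pathMap]
  | cons a l ih => simp [pathMap, ih, Function.comp_assoc]

theorem measurableSet_cycleSupp {F G : Graphing} (l : List (Step F G)) :
    MeasurableSet (cycleSupp (l.map Step.arrow)) := by
  have h : cycleSupp (l.map Step.arrow) =
      ⋂ n : ℕ, (pathMap (l.map Step.arrow))^[n] ⁻¹' pathSrc (l.map Step.arrow) := by
    ext; simp [cycleSupp]
  rw [h]
  exact .iInter fun n => ((measurable_pathMap l).iterate n) (measurableSet_pathSrc l)

theorem pathMap_mem_carrier {F G : Graphing} {u : Microcosm} (hF : F.IsIn u) (hG : G.IsIn u)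
    (l : List (Step F G)) : pathMap (l.map Step.arrow) ∈ u.carrier := by
  induction l with
  | nil => exact u.id_mem
  | cons s l ih =>
    refine u.comp_mem _ ih _ ?_
    rcases s with ⟨e, d⟩ | ⟨e, d⟩
    · exact hF e
    · exact hG e

theorem pathWt_eq_one {F G : Graphing} (hF : ∀ e, (F.arrow e).wt = 1)
    (hG : ∀ e, (G.arrow e).wt = 1) (l : List (Step F G)) : pathWt (l.map Step.arrow) = 1 := by
  refine List.prod_eq_one fun w hw => ?_
  simp only [List.map_map, List.mem_map, Function.comp] at hw
  obtain ⟨⟨e, d⟩ | ⟨e, d⟩, -, rfl⟩ := hw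
  · exact hF e
  · exact hG e

/-- Graphings without any weight `a · 𝟏` do not interact, since `m` vanishes on the other
weights. -/
theorem measurement_eq_zero_of_wt_eq_one {F G : Graphing} (hF : ∀ e, (F.arrow e).wt = 1)
    (hG : ∀ e, (G.arrow e).wt = 1) : measurement F G = 0 := by
  have h1 : Weight.param 1 = 0 := rfl
  simp [measurement, cycleTerm, pathWt_eq_one hF hG, h1]

/-- The steps of a circuit come at least by two. -/
theorem exists_cons_cons_of_cycleChain {F G : Graphing} {l : List (Step F G)} (hl : l ≠ [])
    (hc : Cycle.Chain Step.Follows (l : Cycle (Step F G))) : ∃ s t l', l = s :: t :: l' := by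
  match l, hl, hc with
  | [s], _, hc => exact absurd rfl ((Cycle.chain_singleton _ s).1 hc).1
  | s :: t :: l', _, _ => exact ⟨s, t, l', rfl⟩

theorem follows_getLast_of_cycleChain {F G : Graphing} {s : Step F G} {l : List (Step F G)}
    (hc : Cycle.Chain Step.Follows ((s :: l : List (Step F G)) : Cycle (Step F G))) :
    Step.Follows ((s :: l).getLast (List.cons_ne_nil s l)) s := by
  have h : List.IsChain Step.Follows ((s :: l) ++ [s]) := (Cycle.chain_coe_cons _ s l).1 hc
  refine (List.isChain_append.1 h).2.2 _ ?_ s rfl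
  rw [List.getLast?_eq_getLast_of_ne_nil (List.cons_ne_nil s l)]
  rfl

/-- The points of the support of a circuit follow some edge of `F` to the source of some edge of
`G`, if the edges of `G` do not move points. -/
theorem exists_mem_src_of_mem_cycleSupp {F G : Graphing} (hG : ∀ e y, (G.arrow e).map y = y)
    {l : List (Step F G)} (hl : l ≠ []) (hc : Cycle.Chain Step.Follows (l : Cycle (Step F G)))
    {x : Space} (hx : x ∈ cycleSupp (l.map Step.arrow)) :
    ∃ e e', x ∈ (F.arrow e).src ∧ (F.arrow e).map x ∈ (G.arrow e').src := by
  obtain ⟨s, t, l, rfl⟩ := exists_cons_cons_of_cycleChain hl hc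
  have hc' := List.isChain_cons_cons.1 ((Cycle.chain_coe_cons _ s (t :: l)).1 hc)
  have hx0 := hx 0
  rcases s with ⟨e, d⟩ | ⟨e', d'⟩ <;> rcases t with ⟨e₁, d₁⟩ | ⟨e₁, d₁⟩
  · exact absurd rfl hc'.1.1
  · exact ⟨e, e₁, hx0.1, hx0.2.1⟩
  · have hGx : (G.arrow e').map x = x := hG e' x
    have hsrc : (G.arrow e').map x ∈ (F.arrow e₁).src := hx0.2.1
    cases l with
    | nil =>
      have h1 : (F.arrow e₁).map ((G.arrow e').map x) ∈ (G.arrow e').src := (hx 1).1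
      rw [hGx] at hsrc h1
      exact ⟨e₁, e', hsrc, h1⟩
    | cons v l =>
      rcases v with ⟨e₂, d₂⟩ | ⟨e₂, d₂⟩
      · exact absurd rfl (List.isChain_cons_cons.1 hc'.2).1.1
      · have h1 : (F.arrow e₁).map ((G.arrow e').map x) ∈ (G.arrow e₂).src := hx0.2.2.1
        rw [hGx] at hsrc h1
        exact ⟨e₁, e₂, hsrc, h1⟩
  · exact absurd rfl hc'.1.1

/-! ### Restriction to the common support -/

/-- The restriction of a graphing to the points of `V` that are mapped into `V`. Its edges and its
dialect are left unchanged, so that both graphings have literally the same circuits with any third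
one. -/
def Graphing.restrict (F : Graphing) (V : Set Space) (hV : MeasurableSet V) : Graphing where
  supp := V
  measurableSet_supp := hV
  Dialect := F.Dialect
  finite_dialect := F.finite_dialect
  Edge := F.Edge
  countable_edge := F.countable_edge
  arrow e := { F.arrow e with src := (F.arrow e).src ∩ V ∩ (F.arrow e).map ⁻¹' V }
  measurableSet_src e := ((F.measurableSet_src e).inter hV).inter (F.measurable_map e hV)
  measurable_map e := F.measurable_map e
  src_subset _ _ hx := hx.1.2
  target_subset e := by rintro _ ⟨x, hx, rfl⟩; exact hx.2

/-- A step between `F` and `G`, seen as a step between a restriction of `F` and `G`. -/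
def Step.toRestrict {F G : Graphing} (V : Set Space) (hV : MeasurableSet V) (s : Step F G) :
    Step (F.restrict V hV) G := s

section Restrict

variable {F G : Graphing} {V : Set Space} (hV : MeasurableSet V)

theorem pathMap_toRestrict (l : List (Step F G)) :
    pathMap (l.map fun s => (s.toRestrict V hV).arrow) = pathMap (l.map Step.arrow) := by
  induction l with
  | nil => rfl
  | cons s l ih =>
    simp only [List.map_cons, pathMap, ih]
    rcases s with ⟨e, d⟩ | ⟨e, d⟩ <;> rfl

theorem pathWt_toRestrict (l : List (Step F G)) :
    pathWt (l.map fun s => (s.toRestrict V hV).arrow) = pathWt (l.map Step.arrow) := by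
  simp only [pathWt, List.map_map]
  congr 1
  refine List.map_congr_left fun s _ => ?_
  rcases s with ⟨e, d⟩ | ⟨e, d⟩ <;> rfl

theorem follows_toRestrict :
    (Step.Follows : Step (F.restrict V hV) G → Step (F.restrict V hV) G → Prop) =
      (Step.Follows : Step F G → Step F G → Prop) := by
  funext s t
  rcases s with ⟨e, d⟩ | ⟨e, d⟩ <;> rcases t with ⟨e', d'⟩ | ⟨e', d'⟩ <;> rfl

/-- All the intermediate points of an alternating path lie in the support of `G`; so the only
points to check are the first one and the last one. -/
theorem mem_pathSrc_toRestrict (hG : G.supp = V) (l : List (Step F G))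
    (hl : l.IsChain Step.Follows) (y : Space) (h0 : y ∈ V)
    (hy : y ∈ pathSrc (l.map Step.arrow)) (h1 : pathMap (l.map Step.arrow) y ∈ V) :
    y ∈ pathSrc (l.map fun s => (s.toRestrict V hV).arrow) := by
  induction l generalizing y with
  | nil => trivial
  | cons s l ih =>
    have hs : s.arrow.map y ∈ V := by
      cases l with
      | nil => exact h1
      | cons t l =>
        rcases s with ⟨e, d⟩ | ⟨e, d⟩
        · rcases t with ⟨e', d'⟩ | ⟨e', d'⟩
          · exact absurd rfl (List.isChain_cons_cons.1 hl).1.1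
          · exact hG ▸ G.src_subset e' hy.2.1
        · exact hG ▸ G.target_subset e ⟨y, hy.1, rfl⟩
    have h2 := ih hl.tail (s.arrow.map y) hs hy.2 h1
    rcases s with ⟨e, d⟩ | ⟨e, d⟩
    · exact ⟨⟨⟨hy.1, h0⟩, hs⟩, h2⟩
    · exact ⟨hy.1, h2⟩

theorem pathMap_mem_of_getLast {l : List (Step F G)} (hl : l ≠ [])
    (h : (l.getLast hl).isLeft = false) {y : Space} (hy : y ∈ pathSrc (l.map Step.arrow)) :
    pathMap (l.map Step.arrow) y ∈ G.supp := by
  rw [← List.dropLast_append_getLast hl, List.map_append] at hy ⊢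
  rw [pathSrc_append] at hy
  rw [pathMap_append]
  generalize l.getLast hl = s at *
  rcases s with ⟨e, d⟩ | ⟨e, d⟩
  · exact absurd h (by simp [Step.isLeft])
  · exact G.target_subset e ⟨_, hy.2.1, rfl⟩

/-- Circuits only see the common part of the supports: periodic points never leave it. -/
theorem measurement_le_restrict (hG : G.supp = V) :
    measurement F G ≤ measurement (F.restrict V hV) G := by
  let f : Circuit F G → Circuit (F.restrict V hV) G := fun c =>
    ⟨(c.1 : Cycle (Step F G)), c.2.1, by rw [follows_toRestrict]; exact c.2.2⟩
  have hf : Function.Injective f := fun c c' h => Subtype.ext (Subtype.ext_iff.1 h :)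
  refine le_trans (ENNReal.tsum_le_tsum fun c => ?_) (ENNReal.tsum_comp_le_tsum_of_injective hf _)
  obtain ⟨c, hc⟩ := c
  rw [← Quotient.out_eq c] at hc
  change cycleTerm ((Quotient.out c).map Step.arrow) ≤
    cycleTerm ((Quotient.out c).map fun s => (s.toRestrict V hV).arrow)
  generalize Quotient.out c = l at hc ⊢
  obtain ⟨hl, hc⟩ := hc
  replace hl : l ≠ [] := fun h => hl (by rw [h]; rfl)
  replace hc : Cycle.Chain Step.Follows (l : Cycle (Step F G)) := hc
  unfold cycleTerm
  rw [pathMap_toRestrict, pathWt_toRestrict]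
  have hm : MeasurableSet (cycleSupp (l.map fun s => (s.toRestrict V hV).arrow)) := by
    have h := measurableSet_cycleSupp (l.map (Step.toRestrict V hV))
    rwa [List.map_map] at h
  rw [← lintegral_indicator (measurableSet_cycleSupp l), ← lintegral_indicator hm]
  refine lintegral_mono fun x => ?_
  by_cases hx : x ∈ cycleSupp (l.map Step.arrow)
  swap
  · simp [hx]
  by_cases hp : x ∈ Function.periodicPts (pathMap (l.map Step.arrow))
  swap
  · simp [indicator, hp]
  suffices h : x ∈ cycleSupp (l.map fun s => (s.toRestrict V hV).arrow) by
    simp [hx, h]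
  obtain ⟨n, hn, hper⟩ := hp
  have hV' : ∀ m, (pathMap (l.map Step.arrow))^[m] x ∈ V := by
    intro m
    cases l with
    | nil => exact absurd rfl hl
    | cons s l =>
      rcases s with ⟨e, d⟩ | ⟨e, d⟩
      · -- The last step belongs to `G`; by periodicity the point is the target of that step.
        have hlast := (follows_getLast_of_cycleChain hc).1
        have h := pathMap_mem_of_getLast hl (by simpa [Step.isLeft] using hlast) (hx (m + n - 1))
        rw [← Function.iterate_succ_apply' (pathMap _), show (m + n - 1).succ = m + n by omega,
          Function.iterate_add_apply, hper.eq, hG] at h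
        exact h
      · exact hG ▸ G.src_subset e (hx m).1
  intro m
  rw [pathMap_toRestrict]
  refine mem_pathSrc_toRestrict hV hG l ?_ _ (hV' m) (hx m) ?_
  · cases l with
    | nil => exact absurd rfl hl
    | cons s l => exact (List.isChain_append.1 ((Cycle.chain_coe_cons _ s l).1 hc)).1
  · rw [← Function.iterate_succ_apply' (pathMap (l.map Step.arrow))]
    exact hV' (m + 1)

end Restrict

/-! ### Encoded automata are machines -/

theorem mem_wordSupport {Ψ : Vertex ↪ ℤ} {x : Space} :
    x ∈ wordSupport Ψ ↔ ∃ s d, x.1 = Ψ (.ext s d) := by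
  simp [wordSupport, region]

theorem disjoint_wordSupport_resultSupport (Ψ : Vertex ↪ ℤ) :
    Disjoint (wordSupport Ψ) (resultSupport Ψ) := by
  refine Set.disjoint_left.2 fun x hx hx' => ?_
  obtain ⟨s, d, h⟩ := mem_wordSupport.1 hx
  rcases hx' with h' | h' <;> cases Ψ.injective (h.symm.trans h')

theorem symmDiff_support (Ψ : Vertex ↪ ℤ) :
    ((wordSupport Ψ ∪ resultSupport Ψ) \ wordSupport Ψ) ∪
      (wordSupport Ψ \ (wordSupport Ψ ∪ resultSupport Ψ)) = resultSupport Ψ := by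
  rw [Set.union_sdiff_cancel_left (disjoint_wordSupport_resultSupport Ψ).inter_eq.subset,
    Set.sdiff_eq_empty.2 subset_union_left, union_empty]

theorem supp_bang_wordGraphing (Ψ : Vertex ↪ ℤ) (w : List Bool) {N : ℕ}
    (c : Fin (w.length + 1) ↪ Fin N) :
    ((wordGraphing Ψ w).bang (c : (wordGraphing Ψ w).Dialect ↪ Fin N)).supp = wordSupport Ψ := by
  ext p
  change (p.1, tailSeq p.2) ∈ wordSupport Ψ ↔ p ∈ wordSupport Ψ
  rw [mem_wordSupport, mem_wordSupport]

theorem Microcosm.IsAmbient.microcosm_subset {u : Microcosm} (hu : u.IsAmbient) (k : ℕ) :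
    (microcosm k).carrier ⊆ u.carrier := by
  refine Subset.trans (fun f hf => ?_) (hu.bar_subset k)
  change Generated _ f
  induction hf with
  | one => exact .one
  | basic f h => exact .basic f (Or.inl h)
  | comp f g _ _ hf hg => exact .comp f g hf hg

theorem Project.meas_ofGraphing (a b : ℝ) (F G : Graphing) :
    Project.meas (.ofGraphing a F) (.ofGraphing b G) = a + b + (measurement F G).toReal := by
  change a * ∑ _ : Unit, (1 : ℝ) + b * ∑ _ : Unit, (1 : ℝ) +
    ∑ _ : Unit, ∑ _ : Unit, (1 : ℝ) * 1 * (measurement F G).toReal = _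
  simp

theorem Project.meas_plug_ofGraphing (a b c : ℝ) (F G H : Graphing) :
    Project.meas (.plug (.ofGraphing a F) (.ofGraphing b G)) (.ofGraphing c H) =
      a + b + (measurement F G).toReal + c + (measurement (F.plug G) H).toReal := by
  change Project.meas (.ofGraphing a F) (.ofGraphing b G) * ∑ _ : Unit, (1 : ℝ) +
    c * ∑ _ : Unit × Unit, (1 : ℝ) * 1 +
    ∑ _ : Unit × Unit, ∑ _ : Unit, (1 : ℝ) * 1 * 1 * (measurement (F.plug G) H).toReal = _
  simp [Project.meas_ofGraphing]

namespace Automaton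

variable {k : ℕ} {Q : Type} [NeZero k] [Finite Q] (Ψ : Vertex ↪ ℤ) (A : Automaton k Q)

theorem encode_isIn : (A.encode Ψ).IsIn (microcosm k) := by
  intro e
  change Generated (generators k) (translation _ ∘ permutation _)
  refine .comp _ _ (.basic _ (Or.inl ⟨_, rfl⟩)) (.basic _ (Or.inr ⟨_, fun j hj => ?_, rfl⟩))
  refine Equiv.swap_apply_of_ne_of_ne ?_ ?_
  · have := NeZero.pos k; omega
  · have := (EncEdge.perm e e.transition.2.1.1).2; omega

theorem encode_isFinite : (A.encode Ψ).IsFinite := by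
  refine ⟨A.encode Ψ, ⟨rfl, .refl _, id, fun e => ?_, fun f f' h h' => absurd h' h,
    fun f => ⟨rfl, rfl, rfl, rfl⟩⟩, ?_⟩
  · simp only [id, ofPred_eq_eq_singleton, biUnion_singleton]
    rfl
  · change Finite A.EncEdge
    infer_instance

/-- The unit-wager project on the restriction of `[A]` to the support of words is a test for
`!List`; hence every project of `!List` interacts finitely with it, and so with `[A]`. -/
theorem encode_mem_limp {u : Microcosm} (hu : u.IsAmbient) :
    Project.ofGraphing 0 (A.encode Ψ) ∈
      Project.limp u (wordSupport Ψ) (resultSupport Ψ) (bangList u Ψ) (nBool u Ψ) := by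
  have hA : (A.encode Ψ).IsIn u := fun e => hu.microcosm_subset k (A.encode_isIn Ψ e)
  have hV := measurableSet_wordSupport Ψ
  have hB : Project.ofGraphing 1 ((A.encode Ψ).restrict (wordSupport Ψ) hV) ∈
      Project.orthogonal u (⋃ w, wordReps Ψ w) := by
    refine ⟨fun _ => hA, fun p hp => ?_⟩
    obtain ⟨w, N, c, rfl⟩ := mem_iUnion.1 hp
    have h0 : measurement ((wordGraphing Ψ w).bang c)
        ((A.encode Ψ).restrict (wordSupport Ψ) hV) = 0 :=
      measurement_eq_zero_of_wt_eq_one (fun _ => rfl) (fun _ => rfl)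
    refine ⟨supp_bang_wordGraphing Ψ w c, fun i j _ => ?_, ?_⟩
    · exact h0.trans_ne ENNReal.zero_ne_top
    · rw [Project.meas_ofGraphing, h0]
      simp
  refine ⟨fun _ => hA, rfl, fun a ha => ?_⟩
  obtain ⟨hsupp, hfin, -⟩ := ha.2 _ hB
  replace hsupp : a.supp = wordSupport Ψ := hsupp.symm
  refine ⟨fun i j hij => ?_, fun i l => ?_, ?_⟩
  · exact ne_top_of_le_ne_top (hfin i j hij)
      (measurement_le_restrict hV ((a.slice_supp j).trans hsupp))
  · exact pathMap_mem_carrier hA (ha.1 i.2) l.1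
  · change ((wordSupport Ψ ∪ resultSupport Ψ) \ a.supp) ∪
      (a.supp \ (wordSupport Ψ ∪ resultSupport Ψ)) = resultSupport Ψ
    rw [hsupp, symmDiff_support]

theorem encode_isMachine {u : Microcosm} (hu : u.IsAmbient) :
    IsMachine u Ψ (microcosm k) (A.encode Ψ) where
  isIn := A.encode_isIn Ψ
  mem_type := A.encode_mem_limp Ψ hu
  finite := A.encode_isFinite Ψ
  weight_one _ := rfl

/-- The outcome of the test `T⁻` when the interaction of `[A]` and a word with the test is known
to be either null or infinite. -/
theorem passes_testNeg_iff (w : List Bool) {N : ℕ} (c : Fin (w.length + 1) ↪ Fin N) {ζ : ℝ}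
    (hζ : ζ ≠ 0)
    (h : measurement ((A.encode Ψ).plug ((wordGraphing Ψ w).bang c)) (idReject Ψ) = 0 ∨
      measurement ((A.encode Ψ).plug ((wordGraphing Ψ w).bang c)) (idReject Ψ) = ⊤) :
    Passes (A.encode Ψ) (.ofGraphing 0 ((wordGraphing Ψ w).bang c))
        (.ofGraphing ζ (idReject Ψ)) ↔
      measurement ((A.encode Ψ).plug ((wordGraphing Ψ w).bang c)) (idReject Ψ) = 0 := by
  have h0 : measurement (A.encode Ψ) ((wordGraphing Ψ w).bang c) = 0 :=
    measurement_eq_zero_of_wt_eq_one (fun _ => rfl) (fun _ => rfl)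
  constructor
  · intro hp
    refine h.resolve_right (hp.2.2.1 ((), ()) () ?_)
    simp [Project.plug, Project.ofGraphing]
  · intro hp
    refine ⟨fun _ _ _ => h0.trans_ne ENNReal.zero_ne_top, ?_, fun _ _ _ => ?_, ?_⟩
    · change ((wordSupport Ψ ∪ resultSupport Ψ) \ ((wordGraphing Ψ w).bang c).supp) ∪
        (((wordGraphing Ψ w).bang c).supp \ (wordSupport Ψ ∪ resultSupport Ψ)) = resultSupport Ψ
      rw [supp_bang_wordGraphing, symmDiff_support]
    · exact hp.trans_ne ENNReal.zero_ne_top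
    · rw [Project.meas_plug_ofGraphing, h0, hp]
      simpa using hζ

end Automaton

/-! ### Points and places -/

/-- The points no entry of which lies on the boundary of an interval `[d / N, (d + 1) / N]`. -/
def interiorPoints (N : ℕ) : Set Space := {p | ∀ j (n : ℤ), (N : ℝ) * (p.2 j : ℝ) ≠ n}

theorem lebesgue_compl_interiorPoints {N : ℕ} (hN : 0 < N) : lebesgue (interiorPoints N)ᶜ = 0 := by
  have hN' : (N : ℝ) ≠ 0 := by positivity
  have h : (interiorPoints N)ᶜ ⊆
      ⋃ j : ℕ, ⋃ n : ℤ, {p : Space | (N : ℝ) * (p.2 j : ℝ) = n} := by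
    intro p hp
    simpa [interiorPoints] using hp
  refine measure_mono_null h (measure_iUnion_null fun j => measure_iUnion_null fun n => ?_)
  set T : Set unitInterval := {a | (N : ℝ) * (a : ℝ) = n} with hT
  have hTsub : T.Subsingleton := fun a ha b hb =>
    Subtype.ext (mul_left_cancel₀ hN' (ha.trans hb.symm))
  have hT0 : (volume : Measure unitInterval) T = 0 := by
    rcases hTsub.eq_empty_or_singleton with h | ⟨a, h⟩
    · simp [h]
    · rw [h, ← Set.Icc_self, unitInterval.volume_Icc]; simp
  have hTm : MeasurableSet T := hTsub.measurableSet
  have hpi : Measure.infinitePi (fun _ : ℕ => (volume : Measure unitInterval))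
      ((({j} : Finset ℕ) : Set ℕ).pi fun _ => T) = 0 := by
    rw [Measure.infinitePi_pi _ (fun _ _ => hTm)]
    simp [hT0]
  have heq : {p : Space | (N : ℝ) * (p.2 j : ℝ) = n} =
      univ ×ˢ ((({j} : Finset ℕ) : Set ℕ).pi fun _ => T) := by
    ext p; simp [hT]
  rw [heq, lebesgue, Measure.prod_prod, hpi, mul_zero]

theorem pushMap_translation_fst {N : ℕ} (d d' : Fin N) (z : ℤ) (p : Space) :
    (pushMap N d d' (translation z) p).1 = p.1 + z := rfl

theorem pushMap_translation_snd_of_ne_zero {N : ℕ} (d d' : Fin N) (z : ℤ) (p : Space) {n : ℕ}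
    (hn : n ≠ 0) : (pushMap N d d' (translation z) p).2 n = p.2 n := by
  obtain ⟨m, rfl⟩ := Nat.exists_eq_succ_of_ne_zero hn
  rfl

/-- Away from the boundary of the intervals no reduction modulo `1` takes place. -/
theorem pushMap_translation_snd_zero {N : ℕ} (d d' : Fin N) (z : ℤ) {p : Space}
    (h : (d : ℝ) < N * (p.2 0 : ℝ)) (h' : N * (p.2 0 : ℝ) < d + 1) :
    ((pushMap N d d' (translation z) p).2 0 : ℝ) = p.2 0 + ((d' : ℝ) - d) / N := by
  have hN : (0 : ℝ) < N := by exact_mod_cast d.pos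
  have hd' : ((d' : ℕ) : ℝ) + 1 ≤ N := by exact_mod_cast d'.2
  have hd0 : (0 : ℝ) ≤ ((d' : ℕ) : ℝ) := by positivity
  have key : (p.2 0 : ℝ) + ((d' : ℝ) - d) / N = (N * (p.2 0 : ℝ) - d + d') / N := by
    field_simp; ring
  refine Int.fract_eq_self.2 ?_
  rw [key]
  constructor
  · apply div_nonneg <;> linarith
  · rw [div_lt_one hN]; linarith

theorem letter_eq_none {w : List Bool} {i : Fin (w.length + 1)} (h : letter w i = none) :
    i = 0 := by
  induction i using Fin.cases with
  | zero => rfl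
  | succ i => simp [letter] at h

theorem coe_swap {k : ℕ} [NeZero k] (a b : Fin k) :
    Equiv.swap (0 : ℕ) (a : ℕ) (b : ℕ) = ((Equiv.swap 0 a b : Fin k) : ℕ) := by
  have h := (Fin.val_injective (n := k)).map_swap 0 a b
  rw [h]
  simp

namespace Automaton

variable {k : ℕ} {Q : Type} {A : Automaton k Q}

theorem EncEdge.tgtVertex_of_not_halting (e : A.EncEdge) (h : ¬ A.Halting e.transition.2.2) :
    e.tgtVertex = .ext (e.transition.1.1 e.transition.2.1.1) e.transition.2.1.2 := by
  simp only [Halting, not_or] at h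
  simp [EncEdge.tgtVertex, h]

theorem EncEdge.tgtVertex_eq_ext {e : A.EncEdge} {s : Sym} {d : Dir}
    (h : e.tgtVertex = .ext s d) :
    ¬ A.Halting e.transition.2.2 ∧ e.transition.1.1 e.transition.2.1.1 = s ∧
      e.transition.2.1.2 = d := by
  unfold EncEdge.tgtVertex at h
  split_ifs at h with h1 h2
  cases h
  exact ⟨by simp [Halting, h1, h2], rfl, rfl⟩

theorem EncEdge.tgtVertex_eq_rej {e : A.EncEdge} (h : e.tgtVertex = .rej) :
    e.transition.2.2 = A.reject := by
  unfold EncEdge.tgtVertex at h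
  split_ifs at h with h1 h2
  exact h2

variable [NeZero k] (Ψ : Vertex ↪ ℤ)

/-- The places of storage after an edge: the head that moves gets the first one. -/
def EncEdge.tgtPerm (e : A.EncEdge) : Equiv.Perm (Fin k) :=
  Equiv.swap 0 (e.perm e.transition.2.1.1) * e.perm

theorem EncEdge.tgtPerm_head (e : A.EncEdge) : e.tgtPerm e.transition.2.1.1 = 0 := by
  simp [EncEdge.tgtPerm]

theorem EncEdge.tgtPerm_ne_zero (e : A.EncEdge) {j : Fin k} (hj : j ≠ e.transition.2.1.1) :
    (e.tgtPerm j : ℕ) ≠ 0 := by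
  intro h
  refine hj (e.tgtPerm.injective ?_)
  rw [e.tgtPerm_head]
  exact Fin.ext (by simpa using h)

theorem EncEdge.realiser_snd_tgtPerm (e : A.EncEdge) (y : Space) (j : Fin k) :
    (e.realiser Ψ y).2 (e.tgtPerm j) = y.2 (e.perm j) := by
  change y.2 ((Equiv.swap 0 ((e.perm e.transition.2.1.1 : Fin k) : ℕ)).symm (e.tgtPerm j)) = _
  rw [Equiv.symm_swap, coe_swap]
  simp [EncEdge.tgtPerm]

theorem EncEdge.realiser_snd_of_le (e : A.EncEdge) (y : Space) {n : ℕ} (hn : k ≤ n) :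
    (e.realiser Ψ y).2 n = y.2 n := by
  change y.2 ((Equiv.swap 0 ((e.perm e.transition.2.1.1 : Fin k) : ℕ)).symm n) = _
  rw [Equiv.symm_swap, Equiv.swap_apply_of_ne_of_ne]
  · have := NeZero.pos k; omega
  · have := (e.perm e.transition.2.1.1).2; omega

theorem EncEdge.realiser_mem_region (e : A.EncEdge) {y : Space} (hy : y ∈ region Ψ e.srcVertex) :
    e.realiser Ψ y ∈ region Ψ e.tgtVertex :=
  translation_region Ψ _ _ _ hy

theorem EncEdge.tgtDialect_of_not_halting (e : A.EncEdge) (h : ¬ A.Halting e.transition.2.2) :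
    e.tgtDialect = (e.transition.2.2, e.tgtPerm, e.transition.1.1) := by
  simp [EncEdge.tgtDialect, h, EncEdge.tgtPerm]

end Automaton

namespace Automaton

variable {k : ℕ} {Q : Type} {Ψ : Vertex ↪ ℤ} {A : Automaton k Q}

/-! ### Paths follow computations -/

/-- A head moves along the edge of the word that leaves its place in the chosen direction. -/
theorem move_dir {n : ℕ} (b : Bool) (i : Fin (n + 1)) :
    move (if b then Dir.out else Dir.inn) i = neighbour b i := by
  cases b <;> rfl

theorem stepRel_of_enabled {w : List Bool} {h : Fin k → Fin (w.length + 1)} {q : Q}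
    {t : Transition k Q} (ht : A.Enabled w (h, q) t) :
    A.StepRel w (h, q) (Function.update h t.2.1.1 (move t.2.1.2 (h t.2.1.1)), t.2.2) :=
  ⟨t, ht, rfl⟩

variable [NeZero k]

/-- An edge of `[A]` that comes after an edge of the word reads the symbol at the place that has
just been reached; so it carries a transition enabled in the configuration that the preceding
edge of `[A]` leads to. -/
theorem EncEdge.enabled_of_srcDialect {w : List Bool} {e e' : A.EncEdge}
    {h : Fin k → Fin (w.length + 1)} {p : Fin (w.length + 1)} {d : Dir}
    (hread : e.transition.1.1 = fun j => letter w (h j)) (hhalt : ¬ A.Halting e.transition.2.2) (hD : e.tgtDialect = e'.srcDialect)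
    (hv : e'.srcVertex = .ext (letter w p) d) :
    A.Enabled w (Function.update h e.transition.2.1.1 p, e.transition.2.2) e'.transition ∧
      e'.perm = e.tgtPerm := by
  rcases e' with ⟨t', d'⟩ | ⟨t', a, d', σ'⟩
  · cases d' <;> simp [EncEdge.srcVertex] at hv
  · rw [e.tgtDialect_of_not_halting hhalt] at hD
    obtain ⟨hq, hσ, hs⟩ : e.transition.2.2 = t'.1.1.2 ∧ e.tgtPerm = σ' ∧
        e.transition.1.1 = Function.update t'.1.1.1 (σ'.symm 0) a := by
      simpa [EncEdge.srcDialect] using hD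
    have hi : σ'.symm 0 = e.transition.2.1.1 := by
      rw [← hσ, Equiv.symm_apply_eq, e.tgtPerm_head]
    have hv' : t'.1.1.1 (σ'.symm 0) = letter w p := by
      simp only [EncEdge.srcVertex, Vertex.ext.injEq] at hv
      exact hv.1
    refine ⟨⟨t'.2, hhalt, Prod.ext (funext fun j => ?_) hq.symm⟩, hσ.symm⟩
    change t'.1.1.1 j = letter w (Function.update h e.transition.2.1.1 p j)
    by_cases hj : j = e.transition.2.1.1
    · rw [hj, Function.update_self, ← hi, hv']
    · rw [Function.update_of_ne hj]
      have := congrFun hs j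
      rw [hi, Function.update_of_ne hj, hread] at this
      exact this.symm

variable [Finite Q]

/-- Steps between `[A]` and the representation of `w` that is given by `c`. -/
abbrev WordStep (Ψ : Vertex ↪ ℤ) (A : Automaton k Q) (w : List Bool) {N : ℕ}
    (c : Fin (w.length + 1) ↪ Fin N) : Type :=
  Step (A.encode Ψ) ((wordGraphing Ψ w).bang (c : (wordGraphing Ψ w).Dialect ↪ Fin N))

variable {w : List Bool} {N : ℕ} {c : Fin (w.length + 1) ↪ Fin N}

/-- The step of an edge of `[A]`. -/
def machineStep (Ψ : Vertex ↪ ℤ) (c : Fin (w.length + 1) ↪ Fin N) (e : A.EncEdge) :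
    WordStep Ψ A w c := .inl (e, (0 : Fin 1))

/-- The step of an edge of the word. -/
def wordStep (Ψ : Vertex ↪ ℤ) (c : Fin (w.length + 1) ↪ Fin N) (right : Bool)
    (i : Fin (w.length + 1)) (D : EncDialect k Q) : WordStep Ψ A w c := .inr ((right, i), D)

theorem wordStep_cases (s : WordStep Ψ A w c) :
    (∃ e, s = machineStep Ψ c e) ∨ ∃ b i D, s = wordStep Ψ c b i D := by
  rcases s with ⟨e, d⟩ | ⟨⟨b, i⟩, D⟩
  · have hd : d = (0 : Fin 1) := Subsingleton.elim (α := Fin 1) _ _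
    exact .inl ⟨e, by rw [hd]; rfl⟩
  · exact .inr ⟨b, i, D, rfl⟩

theorem follows_machine_machine {e e' : A.EncEdge} :
    ¬ Step.Follows (machineStep Ψ c e) (machineStep Ψ c e') := fun h => h.1 rfl

theorem follows_word_word {b b' : Bool} {i i' : Fin (w.length + 1)} {D D' : EncDialect k Q} :
    ¬ Step.Follows (wordStep Ψ c b i D : WordStep Ψ A w c) (wordStep Ψ c b' i' D') :=
  fun h => h.1 rfl

theorem follows_machine_word {e : A.EncEdge} {b : Bool} {i : Fin (w.length + 1)}
    {D : EncDialect k Q} :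
    Step.Follows (machineStep Ψ c e) (wordStep Ψ c b i D) ↔ e.tgtDialect = D :=
  ⟨fun h => congrArg Prod.fst h.2, fun h => ⟨Bool.noConfusion, Prod.ext h rfl⟩⟩

theorem follows_word_machine {e : A.EncEdge} {b : Bool} {i : Fin (w.length + 1)}
    {D : EncDialect k Q} :
    Step.Follows (wordStep Ψ c b i D) (machineStep Ψ c e) ↔ D = e.srcDialect :=
  ⟨fun h => congrArg Prod.fst h.2, fun h => ⟨Bool.noConfusion, Prod.ext h rfl⟩⟩

/-- A path from an edge of `[A]`, started at a point that describes a reachable configuration and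
ended in `⟦r⟧`, gives a rejecting trace. The place of the head `j` is given by the entry of index
`σ j`; a head which has not moved yet is at the place `0`, whatever the entry is: when it moves
for the first time, it can only leave `0`, the only place where `⋆` is read. -/
theorem exists_reachable_reject (l : List (WordStep Ψ A w c)) (e : A.EncEdge)
    (h : Fin k → Fin (w.length + 1)) (q : Q) (y : Space)
    (hl : (machineStep Ψ c e :: l).IsChain Step.Follows)
    (hy : y ∈ pathSrc ((machineStep Ψ c e :: l).map Step.arrow)) (hyN : y ∈ interiorPoints N)
    (hend : pathMap ((machineStep Ψ c e :: l).map Step.arrow) y ∈ region Ψ .rej)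
    (hpl : ∀ j, ⌊(N : ℝ) * (y.2 (e.perm j) : ℝ)⌋ = (c (h j) : ℕ) ∨ h j = 0)
    (hreach : A.Reachable w (h, q)) (hen : A.Enabled w (h, q) e.transition) :
    ∃ C : Config k Q w, A.Reachable w C ∧ C.2 = A.reject := by
  induction hn : l.length using Nat.strong_induction_on generalizing l e h q y with
  | _ n ih =>
  have hnext := hreach.tail (stepRel_of_enabled hen)
  have hz₀ : e.realiser Ψ y ∈ region Ψ e.tgtVertex := e.realiser_mem_region Ψ hy.1
  have hread : e.transition.1.1 = fun j => letter w (h j) := congrArg Prod.fst hen.2.2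
  cases l with
  | nil => exact ⟨_, hnext, EncEdge.tgtVertex_eq_rej (Ψ.injective (hz₀.symm.trans hend))⟩
  | cons s l =>
  obtain ⟨e', rfl⟩ | ⟨b, i, D, rfl⟩ := wordStep_cases s
  · exact absurd (List.isChain_cons_cons.1 hl).1 follows_machine_machine
  have hD := follows_machine_word.1 (List.isChain_cons_cons.1 hl).1
  set z₀ := e.realiser Ψ y with hz₀def
  set z := pushMap N (c i) (c (neighbour b i))
    (translation (Ψ (wordTgt w b i) - Ψ (wordSrc w b i))) z₀ with hzdef
  have hz₀src : z₀.1 = Ψ (wordSrc w b i) ∧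
      (((c i : ℕ) : ℝ) ≤ N * (z₀.2 0 : ℝ) ∧ (N : ℝ) * (z₀.2 0 : ℝ) ≤ ((c i : ℕ) : ℝ) + 1) := hy.2.1
  have hz1 : z.1 = Ψ (wordTgt w b i) := by
    rw [hzdef, pushMap_translation_fst, hz₀src.1]; ring
  obtain ⟨hhalt, hsym, hdir⟩ := EncEdge.tgtVertex_eq_ext (Ψ.injective (hz₀.symm.trans hz₀src.1))
  have hz₀0 : z₀.2 0 = y.2 (e.perm e.transition.2.1.1) := by
    have := e.realiser_snd_tgtPerm Ψ y e.transition.2.1.1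
    rwa [e.tgtPerm_head, Fin.val_zero] at this
  have hlt : ((c i : ℕ) : ℝ) < N * (z₀.2 0 : ℝ) := by
    refine lt_of_le_of_ne hz₀src.2.1 fun h => hyN (e.perm e.transition.2.1.1) (c i : ℕ) ?_
    rw [← hz₀0, ← h, Int.cast_natCast]
  have hlt' : (N : ℝ) * (z₀.2 0 : ℝ) < ((c i : ℕ) : ℝ) + 1 := by
    refine lt_of_le_of_ne hz₀src.2.2 fun h => hyN (e.perm e.transition.2.1.1) ((c i : ℕ) + 1) ?_
    rw [← hz₀0, h]; push_cast; rfl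
  -- The edge of the word leaves the place at which the moving head stands.
  have hi : h e.transition.2.1.1 = i := by
    rcases hpl e.transition.2.1.1 with hf | h0
    · rw [← hz₀0, Int.floor_eq_iff] at hf
      have h1 : (c (h e.transition.2.1.1) : ℕ) = (c i : ℕ) := by
        have a1 := hf.1; have a2 := hf.2
        rw [Int.cast_natCast] at a1 a2
        have b1 : ((c (h e.transition.2.1.1) : ℕ) : ℝ) < (c i : ℕ) + 1 := by linarith
        have b2 : ((c i : ℕ) : ℝ) < (c (h e.transition.2.1.1) : ℕ) + 1 := by linarith
        norm_cast at b1 b2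
        omega
      exact c.injective (Fin.ext h1)
    · rw [hread] at hsym
      beta_reduce at hsym
      rw [h0] at hsym
      rw [h0, letter_eq_none hsym.symm]
  have hz0 := pushMap_translation_snd_zero (c i) (c (neighbour b i))
    (Ψ (wordTgt w b i) - Ψ (wordSrc w b i)) hlt hlt'
  rw [← hzdef] at hz0
  have hN : (N : ℝ) ≠ 0 := by have := (c i).pos; positivity
  have hNz0 : (N : ℝ) * (z.2 0 : ℝ) = N * (z₀.2 0 : ℝ) + ((c (neighbour b i) : ℕ) - (c i : ℕ)) := by
    rw [hz0]; field_simp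
  have hz₀N : z₀ ∈ interiorPoints N := fun j m => hyN _ m
  cases l with
  | nil =>
    exact absurd (Ψ.injective (hz1.symm.trans hend)) (by simp [wordTgt])
  | cons s l =>
  obtain ⟨e', rfl⟩ | ⟨b', i', D', rfl⟩ := wordStep_cases s
  swap
  · exact absurd (List.isChain_cons_cons.1 (List.isChain_cons_cons.1 hl).2).1 follows_word_word
  have hD' := follows_word_machine.1 (List.isChain_cons_cons.1 (List.isChain_cons_cons.1 hl).2).1
  have hv : e'.srcVertex = wordTgt w b i :=
    (Ψ.injective (hz1.symm.trans hy.2.2.1)).symm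
  obtain ⟨hen', hperm⟩ := EncEdge.enabled_of_srcDialect (p := neighbour b i) hread hhalt
    (hD.trans hD') hv
  rw [hi, hdir, move_dir] at hnext
  refine ih l.length (by simp only [List.length_cons] at hn; omega) l e' _ _ z
    (List.isChain_cons_cons.1 (List.isChain_cons_cons.1 hl).2).2 hy.2.2 ?_ hend ?_ hnext hen' rfl
  · intro j m
    by_cases hj : j = 0
    · rw [hj, hNz0]
      intro hm
      refine hz₀N 0 (m - ((c (neighbour b i) : ℕ) - (c i : ℕ))) ?_
      push_cast
      linarith
    · rw [hzdef, pushMap_translation_snd_of_ne_zero _ _ _ _ hj]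
      exact hz₀N j m
  · intro j
    rw [hperm]
    by_cases hj : j = e.transition.2.1.1
    · left
      rw [hj, Function.update_self, e.tgtPerm_head, Fin.val_zero, Int.floor_eq_iff, hNz0,
        Int.cast_natCast]
      constructor <;> linarith
    · rw [Function.update_of_ne hj, hzdef,
        pushMap_translation_snd_of_ne_zero _ _ _ _ (e.tgtPerm_ne_zero hj),
        e.realiser_snd_tgtPerm]
      exact hpl j

/-- If `w` is accepted, every circuit between `[A] :: w` and the test has a null support. -/
theorem measurement_eq_zero_of_mem_language (hw : w ∈ A.language) :
    measurement ((A.encode Ψ).plug ((wordGraphing Ψ w).bang c)) (idReject Ψ) = 0 := by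
  have hNpos : 0 < N := (c 0).pos
  refine ENNReal.tsum_eq_zero.2 fun ⟨C, hC⟩ => setLIntegral_measure_zero _ _ ?_
  rw [← Quotient.out_eq C] at hC
  change lebesgue (cycleSupp ((Quotient.out C).map Step.arrow)) = 0
  generalize Quotient.out C = l at hC ⊢
  refine measure_mono_null ?_ (lebesgue_compl_interiorPoints hNpos)
  intro x hx hxN
  have hl : l ≠ [] := fun h => hC.1 (by rw [h]; rfl)
  obtain ⟨⟨P, hne, hP, _⟩, _, ⟨⟨hxP, hxV⟩, -⟩, hrej⟩ :=
    exists_mem_src_of_mem_cycleSupp (fun _ _ => rfl) hl hC.2 hx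
  replace hxV : x ∉ wordSupport Ψ := fun h => hxV
    ⟨Or.inl h, (supp_bang_wordGraphing Ψ w c).symm ▸ h⟩
  cases P with
  | nil => exact hne rfl
  | cons s P =>
  obtain ⟨e, rfl⟩ | ⟨b, i, D, rfl⟩ := wordStep_cases s
  · have hsrc : x ∈ region Ψ e.srcVertex := hxP.1
    rcases e with ⟨t, d⟩ | ⟨t, a, d, σ⟩
    · refine hw (exists_reachable_reject P (Sum.inl (t, d)) (fun _ => 0) A.init x hP hxP hxN hrej
        (fun _ => Or.inr rfl) .refl ⟨t.2.1, ?_, t.2.2⟩)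
      simp [Halting, A.init_ne_accept, A.init_ne_reject]
    · exact hxV (region_subset_wordSupport Ψ _ _ hsrc)
  · refine hxV ?_
    rw [← supp_bang_wordGraphing Ψ w c]
    have hxi : x ∈ (((wordGraphing Ψ w).bang c).arrow (b, i)).src := hxP.1
    exact Graphing.src_subset _ _ hxi

end Automaton

/-! ### Circuits of finite order -/

theorem pathWt_of_forall_eq_or_eq {F G : Graphing} {a b : Step F G} (ha : a.arrow.wt = 1)
    (hb : b.arrow.wt = ⟨1, true⟩) (l : List (Step F G)) (hl : ∀ s ∈ l, s = a ∨ s = b) :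
    (pathWt (l.map Step.arrow)).val = 1 ∧
      (b ∈ l → (pathWt (l.map Step.arrow)).flag = true) := by
  induction l with
  | nil => exact ⟨rfl, fun h => absurd h List.not_mem_nil⟩
  | cons s l ih =>
    obtain ⟨ih1, ih2⟩ := ih fun t ht => hl t (List.mem_cons_of_mem _ ht)
    have hmul : pathWt ((s :: l).map Step.arrow) = s.arrow.wt * pathWt (l.map Step.arrow) := by
      simp [pathWt]
    have hs : s.arrow.wt.val = 1 := by
      rcases hl s List.mem_cons_self with rfl | rfl
      · rw [ha]; rfl
      · rw [hb]
    constructor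
    · rw [hmul]
      change s.arrow.wt.val * (pathWt (l.map Step.arrow)).val = 1
      rw [hs, ih1, one_mul]
    · intro h
      rw [hmul]
      change (s.arrow.wt.flag || (pathWt (l.map Step.arrow)).flag) = true
      rcases List.mem_cons.1 h with rfl | h
      · rw [hb]; rfl
      · rw [ih2 h, Bool.or_true]

theorem Weight.flagged_one_pow {n : ℕ} (hn : 0 < n) : (⟨1, true⟩ : Weight) ^ n = ⟨1, true⟩ := by
  have h : IsIdempotentElem (⟨1, true⟩ : Weight) := Weight.ext (mul_one _) rfl
  obtain ⟨m, rfl⟩ := Nat.exists_eq_succ_of_ne_zero hn.ne'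
  exact h.pow_succ_eq m

section Top

variable {F G : Graphing} {a b : Step F G} {U : Set Space}

theorem exists_pathMap_eq_iterate (ha : U ⊆ a.arrow.src) (hb : U ⊆ b.arrow.src)
    (hb' : ∀ x ∈ U, b.arrow.map x = x) (hmaps : MapsTo a.arrow.map U U) (l : List (Step F G))
    (hl : ∀ s ∈ l, s = a ∨ s = b) :
    ∃ r : ℕ, ∀ x ∈ U, x ∈ pathSrc (l.map Step.arrow) ∧
      pathMap (l.map Step.arrow) x = a.arrow.map^[r] x := by
  induction l with
  | nil => exact ⟨0, fun x _ => ⟨trivial, rfl⟩⟩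
  | cons s l ih =>
    obtain ⟨r, hr⟩ := ih fun t ht => hl t (List.mem_cons_of_mem _ ht)
    rcases hl s List.mem_cons_self with rfl | rfl
    · exact ⟨r + 1, fun x hx => ⟨⟨ha hx, (hr _ (hmaps hx)).1⟩, (hr _ (hmaps hx)).2⟩⟩
    · refine ⟨r, fun x hx => ⟨⟨hb hx, ?_⟩, ?_⟩⟩
      · rw [mem_preimage, hb' x hx]; exact (hr x hx).1
      · change pathMap (l.map Step.arrow) (s.arrow.map x) = _
        rw [hb' x hx]; exact (hr x hx).2

/-- A circuit made of copies of `a` and `b`, in any order, contributes at least `μ(U) / m` when `b`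
is the identity on `U` and `a` has order dividing `m` there. -/
theorem le_cycleTerm (ha : U ⊆ a.arrow.src) (hb : U ⊆ b.arrow.src)
    (hb' : ∀ x ∈ U, b.arrow.map x = x) (hmaps : MapsTo a.arrow.map U U) {m : ℕ} (hm : 0 < m)
    (hper : ∀ x ∈ U, a.arrow.map^[m] x = x) (hwa : a.arrow.wt = 1)
    (hwb : b.arrow.wt = ⟨1, true⟩) (hU : MeasurableSet U) (l : List (Step F G))
    (hl : ∀ s ∈ l, s = a ∨ s = b) (hbl : b ∈ l) :
    1 / (m : ℝ≥0∞) * lebesgue U ≤ cycleTerm (l.map Step.arrow) := by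
  obtain ⟨r, hr⟩ := exists_pathMap_eq_iterate ha hb hb' hmaps l hl
  have hit : ∀ x ∈ U, ∀ n, (pathMap (l.map Step.arrow))^[n] x = a.arrow.map^[r * n] x := by
    intro x hx n
    induction n with
    | zero => rfl
    | succ n ih =>
      rw [Function.iterate_succ_apply', ih, (hr _ (hmaps.iterate _ hx)).2,
        ← Function.iterate_add_apply, Nat.mul_succ, Nat.add_comm]
  have hperl : ∀ x ∈ U, Function.IsPeriodicPt (pathMap (l.map Step.arrow)) m x := by
    intro x hx
    have h : Function.IsPeriodicPt a.arrow.map m x := hper x hx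
    rw [Function.IsPeriodicPt, Function.IsFixedPt, hit x hx]
    exact h.const_mul r
  have hsub : U ⊆ cycleSupp (l.map Step.arrow) := by
    intro x hx n
    rw [hit x hx]
    exact (hr _ (hmaps.iterate _ hx)).1
  have hwt : pathWt (l.map Step.arrow) = ⟨1, true⟩ :=
    Weight.ext (pathWt_of_forall_eq_or_eq hwa hwb l hl).1
      ((pathWt_of_forall_eq_or_eq hwa hwb l hl).2 hbl)
  rw [← setLIntegral_const]
  refine le_trans (setLIntegral_mono' hU fun x hx => ?_) (lintegral_mono_set hsub)
  rw [if_pos (Function.mk_mem_periodicPts hm (hperl x hx)), hwt,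
    Weight.flagged_one_pow ((hperl x hx).minimalPeriod_pos hm)]
  have h1 : Weight.param ⟨1, true⟩ = 1 := by simp [Weight.param]
  rw [h1]
  gcongr
  exact (hperl x hx).minimalPeriod_le hm

/-- The powers of a circuit of finite order on a set of positive measure contribute each at least
the same positive amount, so that the measurement is infinite. -/
theorem measurement_eq_top (hab : Step.Follows a b) (hba : Step.Follows b a)
    (ha : U ⊆ a.arrow.src) (hb : U ⊆ b.arrow.src)
    (hb' : ∀ x ∈ U, b.arrow.map x = x) (hmaps : MapsTo a.arrow.map U U) {m : ℕ} (hm : 0 < m)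
    (hper : ∀ x ∈ U, a.arrow.map^[m] x = x) (hwa : a.arrow.wt = 1)
    (hwb : b.arrow.wt = ⟨1, true⟩) (hU : MeasurableSet U) (hU0 : lebesgue U ≠ 0) :
    measurement F G = ⊤ := by
  let L : ℕ → List (Step F G) := fun n => (List.replicate n [a, b]).flatten
  have hLsucc : ∀ n, L (n + 1) = a :: b :: L n := fun n => by simp [L, List.replicate_succ]
  have hLmem : ∀ n, ∀ s ∈ L n, s = a ∨ s = b := fun n s hs => by
    simp only [L, List.mem_flatten, List.mem_replicate] at hs
    obtain ⟨_, ⟨-, rfl⟩, hs⟩ := hs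
    simpa using hs
  have hLlen : ∀ n, (L n).length = n * 2 := fun n => by simp [L]
  have hLchain : ∀ n, ∃ t, L n ++ [a] = a :: t ∧ (a :: t).IsChain Step.Follows := by
    intro n
    induction n with
    | zero => exact ⟨[], rfl, List.isChain_singleton _⟩
    | succ n ih =>
      obtain ⟨t, ht, hch⟩ := ih
      refine ⟨b :: a :: t, by rw [hLsucc, List.cons_append, List.cons_append, ht], ?_⟩
      exact List.isChain_cons_cons.2 ⟨hab, List.isChain_cons_cons.2 ⟨hba, hch⟩⟩
  let C : ℕ → Circuit F G := fun n => ⟨(L (n + 1) : Cycle (Step F G)), by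
    rw [Ne, Cycle.coe_eq_nil, hLsucc]; exact List.cons_ne_nil _ _, by
    obtain ⟨t, ht, hch⟩ := hLchain (n + 1)
    rw [hLsucc] at ht ⊢
    rw [Cycle.chain_coe_cons]
    rw [List.cons_append] at ht
    rwa [ht]⟩
  have hCinj : Function.Injective C := by
    intro n n' h
    have h' := congrArg Cycle.length (Subtype.ext_iff.1 h)
    simp only [C, Cycle.length_coe, hLlen] at h'
    omega
  refine top_le_iff.1 (le_trans ?_ (ENNReal.tsum_comp_le_tsum_of_injective hCinj _))
  have hc : 1 / (m : ℝ≥0∞) * lebesgue U ≠ 0 :=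
    mul_ne_zero (by simp) hU0
  rw [← ENNReal.tsum_const_eq_top_of_ne_zero (α := ℕ) hc]
  refine ENNReal.tsum_le_tsum fun n => ?_
  have hrot : (Quotient.out (C n).1 : List (Step F G)) ~r L (n + 1) :=
    Quotient.exact (Quotient.out_eq (C n).1)
  refine le_cycleTerm ha hb hb' hmaps hm hper hwa hwb hU _ (fun s hs => ?_) ?_
  · exact hLmem _ s (hrot.mem_iff.1 hs)
  · rw [hrot.mem_iff, hLsucc]; simp

end Top

namespace Automaton

/-! ### Rejecting computations give infinite measurements -/

/-- The points of `⟦r⟧` whose first `k` entries lie in the interior of `[a / N, (a + 1) / N]`. -/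
def startSet (Ψ : Vertex ↪ ℤ) (k : ℕ) {N : ℕ} (a : Fin N) : Set Space :=
  {p | p.1 = Ψ .rej ∧ ∀ j : Fin k, ((a : ℕ) : ℝ) < N * (p.2 j : ℝ) ∧ N * (p.2 j : ℝ) < (a : ℕ) + 1}

theorem startSet_eq_prod (Ψ : Vertex ↪ ℤ) (k : ℕ) {N : ℕ} (a : Fin N) :
    startSet Ψ k a = {Ψ .rej} ×ˢ ((Finset.range k : Set ℕ).pi fun _ =>
      {t : unitInterval | ((a : ℕ) : ℝ) < N * (t : ℝ) ∧ N * (t : ℝ) < (a : ℕ) + 1}) := by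
  ext p
  simp only [startSet, mem_ofPred_eq, mem_prod, mem_singleton_iff, Set.mem_pi, Finset.coe_range,
    mem_Iio]
  exact and_congr_right fun _ => ⟨fun h j hj => h ⟨j, hj⟩, fun h j => h j j.2⟩

theorem measurableSet_cell {N : ℕ} (a : Fin N) :
    MeasurableSet {t : unitInterval | ((a : ℕ) : ℝ) < N * (t : ℝ) ∧ N * (t : ℝ) < (a : ℕ) + 1} := by
  have h0 : Measurable fun t : unitInterval => (N : ℝ) * (t : ℝ) := by fun_prop
  exact (measurableSet_lt measurable_const h0).inter (measurableSet_lt h0 measurable_const)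

theorem measurableSet_startSet (Ψ : Vertex ↪ ℤ) (k : ℕ) {N : ℕ} (a : Fin N) :
    MeasurableSet (startSet Ψ k a) := by
  rw [startSet_eq_prod]
  exact (measurableSet_singleton _).prod
    (MeasurableSet.pi (Finset.countable_toSet _) fun _ _ => measurableSet_cell a)

theorem volume_cell_ne_zero {N : ℕ} (a : Fin N) :
    (volume : Measure unitInterval)
      {t | ((a : ℕ) : ℝ) < N * (t : ℝ) ∧ N * (t : ℝ) < (a : ℕ) + 1} ≠ 0 := by
  have hN : (0 : ℝ) < N := by exact_mod_cast a.pos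
  have ha : ((a : ℕ) : ℝ) + 1 ≤ N := by exact_mod_cast a.2
  have ha0 : (0 : ℝ) ≤ ((a : ℕ) : ℝ) := by positivity
  let x : unitInterval := ⟨(a : ℕ) / N, by positivity, (div_le_one hN).2 (by linarith)⟩
  let y : unitInterval := ⟨((a : ℕ) + 1) / N, by positivity, (div_le_one hN).2 ha⟩
  have hsub : Ioo x y ⊆ {t | ((a : ℕ) : ℝ) < N * (t : ℝ) ∧ N * (t : ℝ) < (a : ℕ) + 1} := by
    intro t ht
    have h1 : ((a : ℕ) : ℝ) / N < t := ht.1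
    have h2 : (t : ℝ) < ((a : ℕ) + 1) / N := ht.2
    rw [div_lt_iff₀ hN] at h1
    rw [lt_div_iff₀ hN] at h2
    exact ⟨by linarith, by linarith⟩
  refine fun h => (measure_mono_null hsub h).not_gt ?_
  rw [unitInterval.volume_Ioo, ENNReal.ofReal_pos, sub_pos]
  exact div_lt_div_of_pos_right (by linarith) hN

theorem lebesgue_startSet_ne_zero (Ψ : Vertex ↪ ℤ) (k : ℕ) {N : ℕ} (a : Fin N) :
    lebesgue (startSet Ψ k a) ≠ 0 := by
  rw [startSet_eq_prod, lebesgue, Measure.prod_prod,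
    Measure.infinitePi_pi _ (fun _ _ => measurableSet_cell a), Measure.count_singleton]
  simp only [one_mul]
  exact Finset.prod_ne_zero_iff.2 fun _ _ => volume_cell_ne_zero a

variable {k : ℕ} {Q : Type} [NeZero k] [Finite Q] {Ψ : Vertex ↪ ℤ} {A : Automaton k Q}
  {w : List Bool} {N : ℕ} {c : Fin (w.length + 1) ↪ Fin N}

/-- The sequence of steps `l`, followed from `startSet`, leads to a description of the
configuration `C`: the point reached is in `⟦v⟧`, the entry that gives the place of the head `j` is
the one of index `σ j`, and the edges of `[A]` to be taken next are those of source dialect `D`. The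
sequence is empty or starts, like every path from `⟦r⟧`, with a starting edge of `[A]`. -/
structure Tracks (c : Fin (w.length + 1) ↪ Fin N) (l : List (WordStep Ψ A w c))
    (C : Config k Q w) (σ : Equiv.Perm (Fin k)) (v : Vertex) (D : EncDialect k Q) : Prop where
  exists_edge : ∀ t, A.Enabled w C t → ∃ e : A.EncEdge,
    e.transition = t ∧ e.perm = σ ∧ e.srcVertex = v ∧ e.srcDialect = D
  isChain : ∀ e : A.EncEdge, e.srcDialect = D →
    (l ++ [machineStep Ψ c e]).IsChain Step.Follows
  exists_head : ∀ e : A.EncEdge, e.srcDialect = D → ∃ (e₀ : A.EncEdge) (l' : _),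
    l ++ [machineStep Ψ c e] = machineStep Ψ c e₀ :: l' ∧
      e₀.srcDialect = (A.init, 1, fun _ => none)
  mem_pathSrc : ∀ x ∈ startSet Ψ k (c 0), x ∈ pathSrc (l.map Step.arrow)
  fst : ∀ x ∈ startSet Ψ k (c 0), (pathMap (l.map Step.arrow) x).1 = Ψ v
  snd : ∀ x ∈ startSet Ψ k (c 0), ∀ j, ((pathMap (l.map Step.arrow) x).2 (σ j) : ℝ) =
    x.2 j + (((c (C.1 j) : ℕ) : ℝ) - (c 0 : ℕ)) / N
  snd_of_le : ∀ x ∈ startSet Ψ k (c 0), ∀ n, k ≤ n →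
    (pathMap (l.map Step.arrow) x).2 n = x.2 n

theorem tracks_init :
    Tracks c ([] : List (WordStep Ψ A w c)) (fun _ => 0, A.init) 1 .rej
      (A.init, 1, fun _ => none) where
  exists_edge t ht := ⟨.inl (⟨t, ht.1, ht.2.2⟩, .out), rfl, rfl, rfl, rfl⟩
  isChain _ _ := List.isChain_singleton _
  exists_head e he := ⟨e, [], rfl, he⟩
  mem_pathSrc _ _ := trivial
  fst _ hx := hx.1
  snd x _ j := by simp [pathMap]
  snd_of_le _ _ _ _ := rfl

theorem Tracks.step {l : List (WordStep Ψ A w c)} {C : Config k Q w} {σ : Equiv.Perm (Fin k)}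
    {v : Vertex} {D : EncDialect k Q} (H : Tracks c l C σ v D) {t : Transition k Q}
    (ht : A.Enabled w C t) (hhalt : ¬ A.Halting t.2.2) :
    ∃ l' σ' v' D', Tracks (Ψ := Ψ) (A := A) c l'
      (Function.update C.1 t.2.1.1 (move t.2.1.2 (C.1 t.2.1.1)), t.2.2) σ' v' D' := by
  obtain ⟨e, rfl, rfl, rfl, rfl⟩ := H.exists_edge t ht
  obtain ⟨h, q⟩ := C
  set p := h e.transition.2.1.1 with hp
  obtain ⟨b, hb⟩ : ∃ b : Bool, e.transition.2.1.2 = if b then Dir.out else Dir.inn := by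
    cases e.transition.2.1.2
    exacts [⟨false, rfl⟩, ⟨true, rfl⟩]
  have hmove : move e.transition.2.1.2 p = neighbour b p := by rw [hb, move_dir]
  have hread : e.transition.1.1 = fun j => letter w (h j) := congrArg Prod.fst ht.2.2
  have htgt : e.tgtVertex = wordSrc w b p := by
    rw [e.tgtVertex_of_not_halting hhalt, hread, hb]
    rfl
  let s := machineStep Ψ c e
  let s' : WordStep Ψ A w c := wordStep Ψ c b p e.tgtDialect
  have hNpos : (0 : ℝ) < N := by exact_mod_cast (c 0).pos
  -- The point in the source of the edge of the word, for a given starting point.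
  have key : ∀ x ∈ startSet Ψ k (c 0),
      (e.realiser Ψ (pathMap (l.map Step.arrow) x)).1 = Ψ (wordSrc w b p) ∧
      ((c p : ℕ) : ℝ) < N * ((e.realiser Ψ (pathMap (l.map Step.arrow) x)).2 0 : ℝ) ∧
      N * ((e.realiser Ψ (pathMap (l.map Step.arrow) x)).2 0 : ℝ) < (c p : ℕ) + 1 := by
    intro x hx
    refine ⟨htgt ▸ e.realiser_mem_region Ψ (H.fst x hx), ?_⟩
    have h0 := e.realiser_snd_tgtPerm Ψ (pathMap (l.map Step.arrow) x) e.transition.2.1.1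
    rw [e.tgtPerm_head, Fin.val_zero] at h0
    have h1 : (N : ℝ) * ((e.realiser Ψ (pathMap (l.map Step.arrow) x)).2 0 : ℝ) =
        N * (x.2 e.transition.2.1.1 : ℝ) + (((c p : ℕ) : ℝ) - (c 0 : ℕ)) := by
      rw [h0, H.snd x hx]
      field_simp
      rfl
    rw [h1]
    have h2 := hx.2 e.transition.2.1.1
    constructor <;> linarith [h2.1, h2.2]
  refine ⟨l ++ [s, s'], e.tgtPerm, wordTgt w b p, e.tgtDialect, ?_, ?_, ?_, ?_, ?_, ?_, ?_⟩
  · intro t' ht'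
    have hread' : t'.1.1 = fun j => letter w
        (Function.update h e.transition.2.1.1 (neighbour b p) j) := by
      rw [← hmove]; exact congrArg Prod.fst ht'.2.2
    have hq' : t'.1.2 = e.transition.2.2 := congrArg Prod.snd ht'.2.2
    have hi : e.tgtPerm.symm 0 = e.transition.2.1.1 := by
      rw [Equiv.symm_apply_eq, e.tgtPerm_head]
    refine ⟨.inr (⟨t', ht'.1⟩, e.transition.1.1 e.transition.2.1.1,
      if b then .inn else .out, e.tgtPerm), rfl, rfl, ?_, ?_⟩
    · simp only [EncEdge.srcVertex, wordTgt, hi, hread', Function.update_self]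
    · rw [e.tgtDialect_of_not_halting hhalt]
      simp only [EncEdge.srcDialect, hi, hq', Prod.mk.injEq, true_and]
      funext j
      by_cases hj : j = e.transition.2.1.1
      · rw [hj, Function.update_self]
      · rw [Function.update_of_ne hj, hread', hread]
        beta_reduce
        rw [Function.update_of_ne hj]
  · intro e' he'
    have h1 : (l ++ s :: [s', machineStep Ψ c e']).IsChain Step.Follows := by
      refine List.isChain_split.2 ⟨H.isChain e rfl, ?_⟩
      exact List.isChain_cons_cons.2 ⟨follows_machine_word.2 rfl,
        List.isChain_cons_cons.2 ⟨follows_word_machine.2 he'.symm, List.isChain_singleton _⟩⟩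
    simpa using h1
  · intro e' he'
    obtain ⟨e₀, l', h1, h2⟩ := H.exists_head e rfl
    refine ⟨e₀, l' ++ [s', machineStep Ψ c e'], ?_, h2⟩
    rw [← List.cons_append, ← h1]
    simp [s]
  · intro x hx
    rw [List.map_append, pathSrc_append]
    obtain ⟨k1, k2, k3⟩ := key x hx
    exact ⟨H.mem_pathSrc x hx, H.fst x hx, ⟨k1, k2.le, k3.le⟩, trivial⟩
  · intro x hx
    rw [List.map_append, pathMap_append]
    change (pushMap N (c p) (c (neighbour b p))
      (translation (Ψ (wordTgt w b p) - Ψ (wordSrc w b p)))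
      (e.realiser Ψ (pathMap (l.map Step.arrow) x))).1 = _
    rw [pushMap_translation_fst, (key x hx).1]
    ring
  · intro x hx j
    rw [List.map_append, pathMap_append]
    change ((pushMap N (c p) (c (neighbour b p))
      (translation (Ψ (wordTgt w b p) - Ψ (wordSrc w b p)))
      (e.realiser Ψ (pathMap (l.map Step.arrow) x))).2 (e.tgtPerm j) : ℝ) = _
    by_cases hj : j = e.transition.2.1.1
    · have h0 := e.realiser_snd_tgtPerm Ψ (pathMap (l.map Step.arrow) x) e.transition.2.1.1
      rw [e.tgtPerm_head, Fin.val_zero] at h0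
      rw [hj, e.tgtPerm_head, Fin.val_zero,
        pushMap_translation_snd_zero _ _ _ (key x hx).2.1 (key x hx).2.2, h0, H.snd x hx]
      simp only [Function.update_self, hmove, ← hp]
      ring
    · rw [pushMap_translation_snd_of_ne_zero _ _ _ _ (e.tgtPerm_ne_zero hj),
        e.realiser_snd_tgtPerm, H.snd x hx]
      simp only [Function.update_of_ne hj]
  · intro x hx n hn
    rw [List.map_append, pathMap_append]
    change (pushMap N (c p) (c (neighbour b p))
      (translation (Ψ (wordTgt w b p) - Ψ (wordSrc w b p)))
      (e.realiser Ψ (pathMap (l.map Step.arrow) x))).2 n = _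
    have hn0 : n ≠ 0 := by have := NeZero.pos k; omega
    rw [pushMap_translation_snd_of_ne_zero _ _ _ _ hn0, e.realiser_snd_of_le Ψ _ hn,
      H.snd_of_le x hx n hn]

theorem exists_tracks {C : Config k Q w} (hC : A.Reachable w C) (hhalt : ¬ A.Halting C.2) :
    ∃ l σ v D, Tracks (Ψ := Ψ) (A := A) c l C σ v D := by
  induction hC with
  | refl => exact ⟨_, _, _, _, tracks_init⟩
  | tail _ hstep ih =>
    obtain ⟨t, ht, rfl⟩ := hstep
    obtain ⟨l, σ, v, D, H⟩ := ih ht.2.1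
    exact H.step ht hhalt

/-- A rejecting trace gives a path that permutes the first `k` entries of the points of `startSet`,
since all the heads come back to the place from which they started. -/
theorem exists_rejecting_path (hA : A.Repositions) (hw : w ∉ A.language) :
    ∃ (l : List (WordStep Ψ A w c)) (e e₀ : A.EncEdge) (l' : List (WordStep Ψ A w c))
      (π : Equiv.Perm (Fin k)),
      l ++ [machineStep Ψ c e] = machineStep Ψ c e₀ :: l' ∧
      e₀.srcDialect = (A.init, 1, fun _ => none) ∧ e.tgtDialect = (A.init, 1, fun _ => none) ∧
      (l ++ [machineStep Ψ c e]).IsChain Step.Follows ∧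
      ∀ x ∈ startSet Ψ k (c 0), x ∈ pathSrc ((l ++ [machineStep Ψ c e]).map Step.arrow) ∧
        (pathMap ((l ++ [machineStep Ψ c e]).map Step.arrow) x).1 = Ψ .rej ∧
        (∀ j, (pathMap ((l ++ [machineStep Ψ c e]).map Step.arrow) x).2 (π j) = x.2 j) ∧
        ∀ n, k ≤ n → (pathMap ((l ++ [machineStep Ψ c e]).map Step.arrow) x).2 n = x.2 n := by
  obtain ⟨C, hC, hrej⟩ := not_not.1 hw
  rcases Relation.ReflTransGen.cases_tail hC with h | ⟨C', hC', t, ht, rfl⟩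
  · exact absurd ((congrArg Prod.snd h).symm.trans hrej) A.init_ne_reject
  replace hrej : t.2.2 = A.reject := hrej
  have hplace := hA w C' t hC' ht (Or.inr hrej)
  obtain ⟨l, σ, v, D, H⟩ := exists_tracks (Ψ := Ψ) (c := c) hC' ht.2.1
  obtain ⟨e, rfl, rfl, rfl, rfl⟩ := H.exists_edge t ht
  obtain ⟨e₀, l', h1, h2⟩ := H.exists_head e rfl
  have htgt : e.tgtVertex = .rej := by
    simp [EncEdge.tgtVertex, hrej, A.accept_ne_reject.symm]
  refine ⟨l, e, e₀, l', e.tgtPerm, h1, h2, ?_, H.isChain e rfl, fun x hx => ?_⟩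
  · simp [EncEdge.tgtDialect, Halting, hrej]
  rw [List.map_append, pathSrc_append, pathMap_append]
  refine ⟨⟨H.mem_pathSrc x hx, H.fst x hx, trivial⟩,
    htgt ▸ e.realiser_mem_region Ψ (H.fst x hx), fun j => ?_, fun n hn => ?_⟩
  · refine (e.realiser_snd_tgtPerm Ψ _ j).trans (Subtype.ext ?_)
    rw [H.snd x hx, hplace j]
    simp
  · exact (e.realiser_snd_of_le Ψ _ hn).trans (H.snd_of_le x hx n hn)

theorem measurement_eq_top_of_notMem_language (hA : A.Repositions) (hw : w ∉ A.language) :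
    measurement ((A.encode Ψ).plug ((wordGraphing Ψ w).bang c)) (idReject Ψ) = ⊤ := by
  obtain ⟨l, e, e₀, l', π, hl, he₀, he, hch, hx⟩ :=
    exists_rejecting_path (Ψ := Ψ) (c := c) hA hw
  set P := l ++ [machineStep Ψ c e] with hPdef
  set f := pathMap (P.map Step.arrow) with hf
  have hU0 := lebesgue_startSet_ne_zero Ψ k (c 0)
  have hPne : P ≠ [] := by simp [hPdef]
  have hP : IsAltPath P :=
    ⟨hPne, hch, fun h => hU0 (measure_mono_null (fun x hxU => (hx x hxU).1) h)⟩
  have hmaps : MapsTo f (startSet Ψ k (c 0)) (startSet Ψ k (c 0)) := by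
    intro x hxU
    obtain ⟨-, h1, h2, -⟩ := hx x hxU
    refine ⟨h1, fun j => ?_⟩
    rw [← π.apply_symm_apply j, h2]
    exact hxU.2 _
  have hiter : ∀ m, ∀ x ∈ startSet Ψ k (c 0), (f^[m] x).1 = Ψ .rej ∧
      (∀ j, (f^[m] x).2 ((π ^ m) j : Fin k) = x.2 j) ∧ ∀ n, k ≤ n → (f^[m] x).2 n = x.2 n := by
    intro m x hxU
    induction m with
    | zero => exact ⟨hxU.1, fun _ => rfl, fun _ _ => rfl⟩
    | succ m ih =>
      obtain ⟨-, h1, h2, h3⟩ := hx _ (hmaps.iterate m hxU)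
      rw [Function.iterate_succ_apply']
      refine ⟨h1, fun j => ?_, fun n hn => (h3 n hn).trans (ih.2.2 n hn)⟩
      rw [pow_succ', Equiv.Perm.mul_apply, h2, ih.2.1]
  have hper : ∀ x ∈ startSet Ψ k (c 0), f^[orderOf π] x = x := by
    intro x hxU
    obtain ⟨h1, h2, h3⟩ := hiter (orderOf π) x hxU
    refine Prod.ext (h1.trans hxU.1.symm) (funext fun n => ?_)
    rcases lt_or_ge n k with hn | hn
    · simpa [pow_orderOf_eq_one] using h2 ⟨n, hn⟩
    · exact h3 n hn
  have hV : ∀ x, x.1 = Ψ .rej →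
      x ∈ ((A.encode Ψ).supp ∩ ((wordGraphing Ψ w).bang c).supp)ᶜ := by
    rintro x hx1 ⟨-, hxV⟩
    rw [supp_bang_wordGraphing] at hxV
    exact Set.disjoint_left.1 (disjoint_wordSupport_resultSupport Ψ) hxV (Or.inr hx1)
  let E : ((A.encode Ψ).plug ((wordGraphing Ψ w).bang c)).Edge := ⟨P, hP⟩
  let D : EncDialect k Q × Fin 1 := ((A.init, 1, fun _ => none), 0)
  have hin : (((A.encode Ψ).plug ((wordGraphing Ψ w).bang c)).arrow E).inn = D := by
    have h : P.head hPne = machineStep Ψ c e₀ := by simp [hl]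
    change (P.head hPne).arrow.inn = D
    rw [h]
    exact Prod.ext he₀ rfl
  have hout : (((A.encode Ψ).plug ((wordGraphing Ψ w).bang c)).arrow E).out = D := by
    have h : P.getLast hPne = machineStep Ψ c e := by simp [hPdef]
    change (P.getLast hPne).arrow.out = D
    rw [h]
    exact Prod.ext he rfl
  let a : Step ((A.encode Ψ).plug ((wordGraphing Ψ w).bang c)) (idReject Ψ) := .inl (E, (0 : Fin 1))
  let b : Step ((A.encode Ψ).plug ((wordGraphing Ψ w).bang c)) (idReject Ψ) := .inr ((), D)
  refine measurement_eq_top (a := a) (b := b) (U := startSet Ψ k (c 0))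
    ⟨Bool.noConfusion, Prod.ext hout rfl⟩ ⟨Bool.noConfusion, Prod.ext hin.symm rfl⟩
    (fun x hxU => ⟨⟨(hx x hxU).1, hV x hxU.1⟩, hV _ (hx x hxU).2.1⟩) (fun x hxU => hxU.1)
    (fun _ _ => rfl) hmaps (orderOf_pos π) hper ?_ rfl (measurableSet_startSet Ψ k (c 0)) hU0
  exact pathWt_eq_one (fun _ => rfl) (fun _ => rfl) P

end Automaton
end InteractionGraphs

theorem mainTheorem2 (u : Microcosm) (hu : u.IsAmbient) (Ψ : Vertex ↪ ℤ)
    (k : ℕ) [NeZero k] (Q : Type) [Finite Q] (A : Automaton k Q) (hA : A.Repositions) :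
    IsMachine u Ψ (microcosm k) (A.encode Ψ) ∧
      languageExists Ψ (testNeg Ψ) (A.encode Ψ) = A.language ∧
      languageForall Ψ (testNeg Ψ) (A.encode Ψ) = A.language := by
  have hpass : ∀ (w : List Bool) (N : ℕ) (c : Fin (w.length + 1) ↪ Fin N) (ζ : ℝ), ζ ≠ 0 →
      (Passes (A.encode Ψ) (.ofGraphing 0 ((wordGraphing Ψ w).bang c))
        (.ofGraphing ζ (idReject Ψ)) ↔ w ∈ A.language) := by
    intro w N c ζ hζ
    by_cases hw : w ∈ A.language
    · have h := Automaton.measurement_eq_zero_of_mem_language (Ψ := Ψ) (c := c) hw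
      exact (A.passes_testNeg_iff Ψ w c hζ (.inl h)).trans (iff_of_true h hw)
    · have h := Automaton.measurement_eq_top_of_notMem_language (Ψ := Ψ) (c := c) hA hw
      refine (A.passes_testNeg_iff Ψ w c hζ (.inr h)).trans (iff_of_false ?_ hw)
      rw [h]
      exact ENNReal.top_ne_zero
  refine ⟨A.encode_isMachine Ψ hu, Set.ext fun w => ⟨fun h => ?_, ?_⟩,
    Set.ext fun w => ⟨fun h => ?_, ?_⟩⟩
  · obtain ⟨_, ⟨N, c, rfl⟩, hp⟩ := h _ ⟨1, one_ne_zero, rfl⟩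
    exact (hpass w N c 1 one_ne_zero).1 hp
  · rintro hw _ ⟨ζ, hζ, rfl⟩
    exact ⟨_, ⟨_, Function.Embedding.refl _, rfl⟩, (hpass w _ _ ζ hζ).2 hw⟩
  · exact (hpass w _ (Function.Embedding.refl _) 1 one_ne_zero).1
      (h _ ⟨1, one_ne_zero, rfl⟩ _ ⟨_, _, rfl⟩)
  · rintro hw _ ⟨ζ, hζ, rfl⟩ _ ⟨N, c, rfl⟩
    exact (hpass w N c ζ hζ).2 hw
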